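/- **Theorem 8.3.** *Setting.* A groupoid $\mathcal H$ is identified with its set of morphisms, with unit space $\mathcal H^0\subset\mathcal H$ and source and range maps $\mathfrak s,\mathfrak r$. Let $\mathcal H$ be a groupoid with a Hausdorff topology for which source, range, inverse and composition are continuous, such that the Borel sets of $\mathcal H$ form a standard Borel structure for which the structure maps (including composition) are Borel, and such that all fibres $\mathfrak s^{-1}(x),\mathfrak r^{-1}(x)$ are countable. A *bisection* is an open $U\subset\mathcal H$ on which $\mathfrak s$ and $\mathfrak r$ are homeomorphisms onto open subsets of $\mathcal H^0$; assume that $\mathcal H$ is *étale* (every element lies in a bisection) and that $\mathcal H^0$ is compact and metrizable. Let $\nu$ be a Borel probability measure on $\mathcal H^0$ with $\nu_{\mathfrak s}=\nu_{\mathfrak r}$, where $\nu_{\mathfrak s}(B)=\int|\mathfrak s^{-1}(x)\cap B|\,d\nu(x)$ and $\nu_{\mathfrak r}(B)=\int|\mathfrak r^{-1}(x)\cap B|\,d\nu(x)$ (*pmp*). The common measure on $\mathcal H$ is also denoted $\nu$ and is assumed to be regular (finite on compact sets, outer regular on Borel sets, inner regular by compact sets on open sets). Let $[[\mathcal H]]$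 be the set of Borel $f\subset\mathcal H$ on which $\mathfrak s$ and $\mathfrak r$ are Borel isomorphisms onto their images, with product $fg=\{ab: a\in f,\ b\in g,\ \mathfrak s(a)=\mathfrak r(b)\}$. Let $[[\mathcal H]]_{\rm top}$ be the set of all $f\in[[\mathcal H]]$ of the form $f=\bigcup_{i=1}^n f_i$ where for each $i$ there is a bisection $U_i$ with $\overline{f_i}\subset U_i$, $\overline{\mathfrak s(f_i)}\subset\mathfrak s(U_i)$, $\overline{\mathfrak r(f_i)}\subset\mathfrak r(U_i)$; the sets $\mathfrak s(f_i)$ are pairwise disjoint Borel sets with $\nu(\partial\,\mathfrak s(f_i))=0$; and likewise for the sets $\mathfrak r(f_i)$. For $d\in\mathbb N$ let $\Delta_d=\{1,\dots,d\}^2$ be the full groupoid, in which $(i,j)$ has source $j$ and range $i$, identify $\Delta_d^0$ with $\{1,\dots,d\}$, and put $[[d]]=[[\Delta_d]]$ and $|E|_d=|E|/d$. Let $\mathrm{Map}([[\mathcal H]],[[d]])$ be the set of all maps $\sigma:f\mapsto\sigma_f$, with the $\sigma$-algebra generated by the sets of all maps agreeing with a given map on a given finite set. Let $J$ be a nonempty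 directed set, $d_j\in\mathbb N$, and let $\mathbb P_j$ be a probability measure on $\mathrm{Map}([[\mathcal H]],[[d_j]])$ for each $j\in J$. Assume that $\mathbb P=\{\mathbb P_j\}$ is a *sofic approximation* to $(\mathcal H,\nu)$, that is: for every finite $F\subset[[\mathcal H]]$ and $\delta>0$, 1. $\mathbb P_j\big(\{\sigma:\big||\sigma_s\cap\Delta_{d_j}^0|_{d_j}-\nu(s\cap\mathcal H^0)\big|<\delta\ \ \forall s\in F\}\big)\to1$ along $J$; 2. for all sufficiently large $j$, $\mathbb P_j$-almost every $\sigma$ satisfies $|\sigma_{st}\,\Delta\,\sigma_s\sigma_t|_{d_j}<\delta$ for all $s,t\in F$; 3. $d_j\to\infty$ along $J$; 4. if $f,f'\in[[\mathcal H]]$ and $\nu(f\Delta f')=0$, then for every $j$, $\sigma_f=\sigma_{f'}$ for $\mathbb P_j$-almost every $\sigma$. Assume also that $\mathbb P$ is *asymptotically continuous*: for every finite $F\subset[[\mathcal H]]$ and $\delta>0$, for all sufficiently large $j$, $\mathbb P_j$-almost every $\sigma$ satisfies $|\sigma_f\Delta\sigma_g|_{d_j}<\delta+\nu(f\Delta g)$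 for all $f,g\in F$. Let $p\in[1,\infty]$ and let $\beta$ be a *bias*: $\lim_{j\to\beta}$ is either $\liminf$ along $J$, or $\limsup$ along $J$, or the limit along an ultrafilter on $J$ containing all sets $\{j':j'\ge j\}$; the limits are taken in $[-\infty,\infty]$, and $\log0=-\infty$. Let $(\mathcal G,\mu)$ be a standard Borel groupoid with Borel structure maps and countable source and range fibres, $\mu$ a Borel probability measure on $\mathcal G^0$ with $\mu_{\mathfrak s}=\mu_{\mathfrak r}$. A *pmp class-bijective extension* $\pi:(\mathcal G,\mu)\to(\mathcal H,\nu)$ is a surjective Borel groupoid morphism which restricts to bijections $\mathfrak s^{-1}(a)\to\mathfrak s^{-1}(\pi(a))$ and $\mathfrak r^{-1}(a)\to\mathfrak r^{-1}(\pi(a))$ for every $a\in\mathcal G^0$ and satisfies $\pi_*\mu=\nu$ on the unit spaces. For $f\in[[\mathcal H]]$ and $P\subset\mathcal G^0$ put $f\cdot P=\{\mathfrak r(g):\pi(g)\in f,\ \mathfrak s(g)\in P\}$; for $\tau\in[[d]]$ and $A\subset\{1,\dots,d\}$ put $\tau\cdot A=\{i:(i,k)\in\tau\text{ for some }k\in A\}$.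 Let $\mathcal Q\le\mathcal P$ be finite Borel partitions of $\mathcal G^0$ ($\mathcal P$ refines $\mathcal Q$). Let $\Sigma(\cdot)$ denote the $\sigma$-algebra generated by a partition. For finite $F\subset[[\mathcal H]]$ with $\mathcal H^0\in F$ let $\mathcal P^F$ be the coarsest partition of $\mathcal G^0$ such that each $f\cdot P$ ($f\in F$, $P\in\mathcal P$) is a union of parts. For $\sigma\in\mathrm{Map}([[\mathcal H]],[[d]])$ and $\delta>0$ let $\mathrm{Hom}(\pi,\sigma,\mathcal P,F,\delta)$ be the set of all homomorphisms $\phi:\Sigma(\mathcal P^F)\to 2^{\{1,\dots,d\}}$ (maps preserving finite unions, finite intersections, the empty set and the whole space) such that $$\sum_{P\in\mathcal P}|\sigma_f\cdot\phi(P)\,\Delta\,\phi(f\cdot P)|_d<\delta\quad\forall f\in F,\qquad \sum_{P\in\mathcal P^F}\big||\phi(P)|_d-\mu(P)\big|<\delta,$$ and let $|\mathrm{Hom}(\pi,\sigma,\mathcal P,F,\delta)|_{\mathcal Q}$ be the number of distinct restrictions to $\Sigma(\mathcal Q)$ of elements of this set. Define $$h_{\mathbb P,\mu}(\pi,\mathcal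 Q,\mathcal P)=\inf_{F}\ \inf_{\delta>0}\ \lim_{j\to\beta}\frac1{d_j}\log\big\||\mathrm{Hom}(\pi,\cdot,\mathcal P,F,\delta)|_{\mathcal Q}\big\|_{L^p(\mathbb P_j)},$$ the first infimum being over all finite $F\subset[[\mathcal H]]$ with $\mathcal H^0\in F$. *Conclusion.* For every such $p$, $\beta$, every pmp class-bijective extension $\pi:(\mathcal G,\mu)\to(\mathcal H,\nu)$ and all finite Borel partitions $\mathcal Q\le\mathcal P$ of $\mathcal G^0$, $$h_{\mathbb P,\mu}(\pi,\mathcal Q,\mathcal P)=\inf_{F}\ \inf_{\delta>0}\ \lim_{j\to\beta}\frac1{d_j}\log\big\||\mathrm{Hom}(\pi,\cdot,\mathcal P,F,\delta)|_{\mathcal Q}\big\|_{L^p(\mathbb P_j)},$$ where now the first infimum is over all finite $F\subset[[\mathcal H]]_{\rm top}$ with $\mathcal H^0\in F$. -/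

import Mathlib

open MeasureTheory Filter Topology Set
open scoped ENNReal

namespace SoficEntropy

theorem exists_isCompact_of_lt_measure_range {X : Type*} [TopologicalSpace X] [T2Space X]
    [RegularSpace X] [MeasurableSpace X] [BorelSpace X] (μ : Measure X) [IsFiniteMeasure μ]
    (f : (ℕ → ℕ) → X) (hf : Continuous f) (c : ℝ≥0∞) (hc : c < μ (range f)) :
    ∃ K : Set X, IsCompact K ∧ K ⊆ range f ∧ c ≤ μ K := by
  have step : ∀ (k : ℕ) (S : Set (ℕ → ℕ)), c < μ (f '' S) →
      ∃ m : ℕ, c < μ (f '' (S ∩ {x | x k ≤ m})) := by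
    intro k S hS
    have h1 : f '' S = ⋃ m : ℕ, f '' (S ∩ {x | x k ≤ m}) := by
      rw [← image_iUnion, ← inter_iUnion]
      congr 1
      ext x
      simp only [mem_inter_iff, mem_iUnion, mem_ofPred_eq]
      exact ⟨fun h => ⟨h, x k, le_rfl⟩, fun h => h.1⟩
    have h2 : Monotone fun m : ℕ => f '' (S ∩ {x | x k ≤ m}) := by
      intro a b hab
      exact image_mono (inter_subset_inter_right _ fun x (hx : x k ≤ a) => le_trans hx hab)
    rw [h1, h2.measure_iUnion] at hS
    exact lt_iSup_iff.1 hS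
  choose! m hm using step
  let S : ℕ → Set (ℕ → ℕ) := fun k => Nat.rec univ (fun k T => T ∩ {x | x k ≤ m k T}) k
  have hS : ∀ k, c < μ (f '' S k) := by
    intro k
    induction k with
    | zero => simpa [S] using hc
    | succ k ih => exact hm k (S k) ih
  let n : ℕ → ℕ := fun k => m k (S k)
  have hSn : ∀ k, ∀ x ∈ S k, ∀ i < k, x i ≤ n i := by
    intro k
    induction k with
    | zero => intro x _ i hi; omega
    | succ k ih =>
      intro x hx i hi
      rcases Nat.lt_succ_iff_lt_or_eq.1 hi with h | h
      · exact ih x hx.1 i h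
      · subst h; exact hx.2
  let K : Set (ℕ → ℕ) := Set.pi univ fun i => Iic (n i)
  have hK : IsCompact K := isCompact_univ_pi fun i => (finite_Iic (n i)).isCompact
  have hfK : IsCompact (f '' K) := hK.image hf
  refine ⟨f '' K, hfK, image_subset_range _ _, ?_⟩
  have key : ⋂ k, closure (f '' S k) ⊆ f '' K := by
    intro y hy
    by_contra hyK
    obtain ⟨U, V, hU, hV, hKU, hyV, hUV⟩ :=
      SeparatedNhds.of_isCompact_isClosed hfK (isClosed_singleton (x := y))
        (disjoint_singleton_right.2 hyK)
    have hex : ∀ k, ∃ x ∈ S k, f x ∉ U := by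
      intro k
      obtain ⟨z, hz1, hz2⟩ := mem_closure_iff.1 (mem_iInter.1 hy k) V hV (hyV rfl)
      obtain ⟨x, hx, rfl⟩ := hz2
      exact ⟨x, hx, fun h => disjoint_left.1 hUV h hz1⟩
    choose x hx hxU using hex
    let x' : ℕ → ℕ → ℕ := fun k i => min (x k i) (n i)
    have hx'K : ∀ k, x' k ∈ K := fun k i _ => mem_Iic.2 (min_le_right _ _)
    obtain ⟨z, hzK, hz⟩ := hK.ultrafilter_le_nhds ((hyperfilter ℕ).map x')
      (le_principal_iff.2 (Eventually.of_forall hx'K : ∀ᶠ k in (hyperfilter ℕ : Filter ℕ), x' k ∈ K))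
    have ht : Tendsto x (hyperfilter ℕ : Filter ℕ) (𝓝 z) := by
      have hz' : Tendsto x' (hyperfilter ℕ : Filter ℕ) (𝓝 z) := hz
      rw [tendsto_pi_nhds] at hz' ⊢
      intro i
      refine (hz' i).congr' ?_
      have : ∀ᶠ k in (hyperfilter ℕ : Filter ℕ), i < k :=
        (Nat.hyperfilter_le_atTop) (eventually_gt_atTop i)
      filter_upwards [this] with k hk
      exact min_eq_left (hSn k (x k) (hx k) i hk)
    have hz2 : ∀ᶠ k in (hyperfilter ℕ : Filter ℕ), f (x k) ∈ U :=
      (hf.tendsto z).comp ht (hU.mem_nhds (hKU ⟨z, hzK, rfl⟩))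
    obtain ⟨k, hk⟩ := hz2.exists
    exact hxU k hk
  have hanti : Antitone fun k => closure (f '' S k) :=
    antitone_nat_of_succ_le fun k => closure_mono (image_mono inter_subset_left)
  calc c ≤ ⨅ k, μ (closure (f '' S k)) :=
        le_iInf fun k => (hS k).le.trans (measure_mono subset_closure)
    _ = μ (⋂ k, closure (f '' S k)) :=
        (hanti.measure_iInter (fun k => isClosed_closure.measurableSet.nullMeasurableSet)
          ⟨0, measure_ne_top _ _⟩).symm
    _ ≤ μ (f '' K) := measure_mono key

theorem nullMeasurableSet_of_analyticSet {X : Type*} [TopologicalSpace X] [T2Space X]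
    [RegularSpace X] [MeasurableSpace X] [BorelSpace X] (μ : Measure X) [IsFiniteMeasure μ]
    {A : Set X} (hA : AnalyticSet A) : NullMeasurableSet A μ := by
  rw [AnalyticSet] at hA
  rcases hA with rfl | ⟨f, hf, rfl⟩
  · exact MeasurableSet.empty.nullMeasurableSet
  rcases eq_or_ne (μ (range f)) 0 with h0 | h0
  · exact NullMeasurableSet.of_null h0
  obtain ⟨c, -, hc, hlim⟩ := exists_seq_strictMono_tendsto' (pos_iff_ne_zero.2 h0)
  have hK := fun n => exists_isCompact_of_lt_measure_range μ f hf (c n) (hc n).2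
  choose K hK hKs hKc using hK
  have hM : MeasurableSet (⋃ n, K n) := .iUnion fun n => (hK n).measurableSet
  have h := ae_eq_of_subset_of_measure_ge (iUnion_subset hKs)
    (le_of_tendsto' hlim fun n => (hKc n).trans (measure_mono (subset_iUnion K n)))
    hM.nullMeasurableSet (measure_ne_top μ _)
  exact hM.nullMeasurableSet.congr h

theorem encard_eq_iSup_tsum {H : Type*} (e : H → ℝ) (he : Function.Injective e) (T : Set H) :
    (T.encard : ℝ≥0∞) =
      ⨆ k : ℕ, ∑' i : ℤ, ((fun h => ⌊(2 : ℝ) ^ k * e h⌋) '' T).indicator (fun _ => (1 : ℝ≥0∞)) i := by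
  have hk : ∀ S : Set ℤ, ∑' i : ℤ, S.indicator (fun _ => (1 : ℝ≥0∞)) i = S.encard := by
    intro S
    rw [← tsum_subtype S (fun _ => (1 : ℝ≥0∞)), ENNReal.tsum_set_one]
  simp_rw [hk]
  apply le_antisymm
  · by_contra! hlt
    set s := ⨆ k : ℕ, (((fun h => ⌊(2 : ℝ) ^ k * e h⌋) '' T).encard : ℝ≥0∞) with hs
    have hfin : ∀ F : Finset H, (F : Set H) ⊆ T → (F.card : ℝ≥0∞) ≤ s := by
      intro F hF
      have hev : ∀ᶠ k : ℕ in atTop, ∀ a ∈ F, ∀ b ∈ F,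
          ⌊(2 : ℝ) ^ k * e a⌋ = ⌊(2 : ℝ) ^ k * e b⌋ → a = b := by
        refine (Finset.eventually_all F).2 fun a _ => (Finset.eventually_all F).2 fun b _ => ?_
        rcases eq_or_ne a b with rfl | hab
        · exact Eventually.of_forall fun _ _ => rfl
        have hpos : 0 < |e a - e b| := abs_pos.2 (sub_ne_zero.2 (he.ne hab))
        have ht : Tendsto (fun k : ℕ => (2 : ℝ) ^ k * |e a - e b|) atTop atTop :=
          (tendsto_pow_atTop_atTop_of_one_lt one_lt_two).atTop_mul_const hpos
        filter_upwards [ht.eventually_ge_atTop 1] with k hk heq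
        have := Int.abs_sub_lt_one_of_floor_eq_floor heq
        rw [← mul_sub, abs_mul, abs_of_pos (by positivity : (0 : ℝ) < 2 ^ k)] at this
        linarith
      obtain ⟨k, hk⟩ := hev.exists
      have hinj : InjOn (fun h => ⌊(2 : ℝ) ^ k * e h⌋) (F : Set H) :=
        fun a ha b hb h => hk a ha b hb h
      refine le_trans ?_ (le_iSup (fun k : ℕ =>
        (((fun h => ⌊(2 : ℝ) ^ k * e h⌋) '' T).encard : ℝ≥0∞)) k)
      have : (F.card : ℕ∞) ≤ ((fun h => ⌊(2 : ℝ) ^ k * e h⌋) '' T).encard := by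
        rw [← encard_coe_eq_coe_finsetCard, ← hinj.encard_image]
        exact encard_le_encard (image_mono hF)
      exact_mod_cast ENat.toENNReal_mono this
    have hs' : s ≠ ∞ := hlt.ne_top
    obtain ⟨N, hN⟩ := ENNReal.exists_nat_gt hs'
    rcases T.finite_or_infinite with hT | hT
    · have := hfin hT.toFinset (by simp)
      rw [← hT.coe_toFinset, encard_coe_eq_coe_finsetCard] at hlt
      simp only [ENat.toENNReal_coe] at hlt
      exact absurd this (not_le.2 hlt)
    · obtain ⟨F, hF, hc⟩ := hT.exists_subset_card_eq N
      have := hfin F hF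
      rw [hc] at this
      exact absurd this (not_le.2 hN)
  · exact iSup_le fun k => ENat.toENNReal_mono (encard_image_le _ _)

theorem aemeasurable_encard_fiber {X H : Type*} [MeasurableSpace X] [StandardBorelSpace X]
    [MeasurableSpace H] [StandardBorelSpace H] (ν : Measure X) [IsFiniteMeasure ν]
    {q : H → X} (hq : Measurable q) {B : Set H} (hB : MeasurableSet B) :
    AEMeasurable (fun x => ((q ⁻¹' {x} ∩ B).encard : ℝ≥0∞)) ν := by
  have hfun : (fun x => ((q ⁻¹' {x} ∩ B).encard : ℝ≥0∞)) = fun x => ⨆ k : ℕ, ∑' i : ℤ,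
      (q '' (B ∩ (fun h => ⌊(2 : ℝ) ^ k * embeddingReal H h⌋) ⁻¹' {i})).indicator
        (fun _ => (1 : ℝ≥0∞)) x := by
    funext x
    rw [encard_eq_iSup_tsum _ (measurableEmbedding_embeddingReal H).injective]
    refine iSup_congr fun k => tsum_congr fun i => ?_
    refine indicator_eq_indicator ?_ rfl
    constructor
    · rintro ⟨h, ⟨hx, hB⟩, hi⟩
      exact ⟨h, ⟨hB, hi⟩, hx⟩
    · rintro ⟨h, ⟨hB, hi⟩, hx⟩
      exact ⟨h, ⟨hx, hB⟩, hi⟩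
  rw [hfun]
  let := upgradeStandardBorel X
  refine AEMeasurable.iSup fun k => AEMeasurable.tsum fun i =>
    aemeasurable_const.indicator₀ (nullMeasurableSet_of_analyticSet ν ?_)
  refine MeasurableSet.analyticSet_image (hB.inter ?_) hq
  have : Measurable fun h => ⌊(2 : ℝ) ^ k * embeddingReal H h⌋ :=
    Int.measurable_floor.comp ((measurable_embeddingReal H).const_mul _)
  exact this (measurableSet_singleton i)

/-- The measure `B ↦ ∫ |q⁻¹(x) ∩ B| dν(x)`. -/
noncomputable def fiberCount {X H : Type*} [MeasurableSpace X] [StandardBorelSpace X]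
    [MeasurableSpace H] [StandardBorelSpace H] (ν : Measure X) [IsFiniteMeasure ν]
    (q : H → X) (hq : Measurable q) : Measure H :=
  Measure.ofMeasurable (fun B _ => ∫⁻ x, ((q ⁻¹' {x} ∩ B).encard : ℝ≥0∞) ∂ν) (by simp) (by
    intro B hB hd
    rw [← lintegral_tsum fun i => aemeasurable_encard_fiber ν hq (hB i)]
    refine lintegral_congr fun x => ?_
    have hx : MeasurableSet (q ⁻¹' {x}) := hq (measurableSet_singleton x)
    have := measure_iUnion (μ := (Measure.count : Measure H)) (f := fun i => q ⁻¹' {x} ∩ B i)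
      (fun i j hij => (hd hij).mono inter_subset_right inter_subset_right)
      (fun i => hx.inter (hB i))
    rw [← inter_iUnion, Measure.count_apply (hx.inter (.iUnion hB))] at this
    simpa only [Measure.count_apply (hx.inter (hB _))] using this)

theorem fiberCount_apply {X H : Type*} [MeasurableSpace X] [StandardBorelSpace X]
    [MeasurableSpace H] [StandardBorelSpace H] (ν : Measure X) [IsFiniteMeasure ν]
    (q : H → X) (hq : Measurable q) {B : Set H} (hB : MeasurableSet B) :
    fiberCount ν q hq B = ∫⁻ x, ((q ⁻¹' {x} ∩ B).encard : ℝ≥0∞) ∂ν :=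
  Measure.ofMeasurable_apply B hB

/-- A groupoid with set of objects `X` and set of morphisms `H`. The objects are regarded as
morphisms through `unit`, and `comp f g` is defined when the source of `f` is the range of `g`. -/
structure GroupoidStr (X H : Type*) where
  src : H → X
  rng : H → X
  unit : X → H
  comp : (f g : H) → src f = rng g → H
  inv : H → H
  src_unit : ∀ x, src (unit x) = x
  rng_unit : ∀ x, rng (unit x) = x
  src_comp : ∀ f g h, src (comp f g h) = src g
  rng_comp : ∀ f g h, rng (comp f g h) = rng f
  comp_assoc : ∀ (f g k : H) (hfg : src f = rng g) (hgk : src g = rng k),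
    comp (comp f g hfg) k ((src_comp f g hfg).trans hgk) =
      comp f (comp g k hgk) (hfg.trans (rng_comp g k hgk).symm)
  unit_comp : ∀ f, comp (unit (rng f)) f (src_unit _) = f
  comp_unit : ∀ f, comp f (unit (src f)) (rng_unit _).symm = f
  src_inv : ∀ f, src (inv f) = rng f
  rng_inv : ∀ f, rng (inv f) = src f
  inv_comp : ∀ f, comp (inv f) f (src_inv f) = unit (src f)
  comp_inv : ∀ f, comp f (inv f) (rng_inv f).symm = unit (rng f)

namespace GroupoidStr

variable {X H : Type*}

/-- The set of units, as a set of morphisms. -/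
def units (𝓗 : GroupoidStr X H) : Set H := range 𝓗.unit

/-- The set of composable pairs. -/
def Composable (𝓗 : GroupoidStr X H) : Set (H × H) := {q | 𝓗.src q.1 = 𝓗.rng q.2}

/-- The composition as a map on the composable pairs. -/
def compMap (𝓗 : GroupoidStr X H) (q : 𝓗.Composable) : H := 𝓗.comp q.1.1 q.1.2 q.2

/-- The product `AB` of two sets of morphisms. -/
def setMul (𝓗 : GroupoidStr X H) (A B : Set H) : Set H :=
  {h | ∃ a ∈ A, ∃ b ∈ B, ∃ hab : 𝓗.src a = 𝓗.rng b, h = 𝓗.comp a b hab}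

/-- `f · P`, the set of ranges of the elements of `f` with source in `P`. -/
def act (𝓗 : GroupoidStr X H) (f : Set H) (P : Set X) : Set X :=
  𝓗.rng '' (f ∩ 𝓗.src ⁻¹' P)

end GroupoidStr

/-- A discrete measurable groupoid: the structure maps are Borel and the source and range fibres
are countable. It is used with standard Borel `X` and `H`; the set of units and the set of
composable pairs are then automatically Borel. -/
structure DiscreteBorelGroupoid (X H : Type*) [MeasurableSpace X] [MeasurableSpace H]
    extends GroupoidStr X H where
  measurable_src : Measurable src
  measurable_rng : Measurable rng
  measurable_unit : Measurable unit
  measurable_comp : Measurable toGroupoidStr.compMap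
  measurable_inv : Measurable inv
  countable_src : ∀ x, (src ⁻¹' {x}).Countable
  countable_rng : ∀ x, (rng ⁻¹' {x}).Countable

namespace DiscreteBorelGroupoid

section Basic

variable {X H : Type*} [MeasurableSpace X] [MeasurableSpace H]

/-- `f ∈ ⟦𝓗⟧`: `f` is Borel and the source and range maps restricted to `f` are Borel isomorphisms
onto their images. -/
def IsPartialAut (𝓗 : DiscreteBorelGroupoid X H) (f : Set H) : Prop :=
  MeasurableSet f ∧ MeasurableEmbedding (f.domRestrict 𝓗.src) ∧
    MeasurableEmbedding (f.domRestrict 𝓗.rng)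

/-- The semigroup of partial automorphisms `⟦𝓗⟧`. -/
def PartialAut (𝓗 : DiscreteBorelGroupoid X H) : Type _ := {f : Set H // 𝓗.IsPartialAut f}

variable [StandardBorelSpace X] [StandardBorelSpace H]

theorem isPartialAut_of_injOn (𝓗 : DiscreteBorelGroupoid X H) {f : Set H} (hf : MeasurableSet f)
    (hs : InjOn 𝓗.src f) (hr : InjOn 𝓗.rng f) : 𝓗.IsPartialAut f := by
  have := hf.standardBorel
  exact ⟨hf, (𝓗.measurable_src.comp measurable_subtype_coe).measurableEmbedding hs.injective,
    (𝓗.measurable_rng.comp measurable_subtype_coe).measurableEmbedding hr.injective⟩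

theorem IsPartialAut.setMul {𝓗 : DiscreteBorelGroupoid X H} {f g : Set H}
    (hf : 𝓗.IsPartialAut f) (hg : 𝓗.IsPartialAut g) : 𝓗.IsPartialAut (𝓗.setMul f g) := by
  have hfs : InjOn 𝓗.src f := injOn_iff_injective.2 hf.2.1.injective
  have hfr : InjOn 𝓗.rng f := injOn_iff_injective.2 hf.2.2.injective
  have hgs : InjOn 𝓗.src g := injOn_iff_injective.2 hg.2.1.injective
  have hgr : InjOn 𝓗.rng g := injOn_iff_injective.2 hg.2.2.injective
  have hC : MeasurableSet 𝓗.Composable :=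
    measurableSet_eq_fun (𝓗.measurable_src.comp measurable_fst)
      (𝓗.measurable_rng.comp measurable_snd)
  have := hC.standardBorel
  have himg : 𝓗.setMul f g =
      𝓗.compMap '' ((fun q : 𝓗.Composable => (q : H × H)) ⁻¹' (f ×ˢ g)) := by
    ext h
    constructor
    · rintro ⟨a, ha, b, hb, hab, rfl⟩
      exact ⟨⟨(a, b), hab⟩, ⟨ha, hb⟩, rfl⟩
    · rintro ⟨⟨⟨a, b⟩, hab⟩, ⟨ha, hb⟩, rfl⟩
      exact ⟨a, ha, b, hb, hab, rfl⟩
  have hsrc : InjOn 𝓗.src (𝓗.setMul f g) := by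
    rintro _ ⟨a, ha, b, hb, hab, rfl⟩ _ ⟨a', ha', b', hb', hab', rfl⟩ he
    rw [𝓗.src_comp, 𝓗.src_comp] at he
    obtain rfl := hgs hb hb' he
    obtain rfl := hfs ha ha' (hab.trans hab'.symm)
    rfl
  have hrng : InjOn 𝓗.rng (𝓗.setMul f g) := by
    rintro _ ⟨a, ha, b, hb, hab, rfl⟩ _ ⟨a', ha', b', hb', hab', rfl⟩ he
    rw [𝓗.rng_comp, 𝓗.rng_comp] at he
    obtain rfl := hfr ha ha' he
    obtain rfl := hgr hb hb' (hab.symm.trans hab')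
    rfl
  refine isPartialAut_of_injOn 𝓗 ?_ hsrc hrng
  rw [himg]
  refine MeasurableSet.image_of_measurable_injOn
    (measurable_subtype_coe (hf.1.prod hg.1)) 𝓗.measurable_comp ?_
  rintro ⟨⟨a, b⟩, hab⟩ ⟨ha, hb⟩ ⟨⟨a', b'⟩, hab'⟩ ⟨ha', hb'⟩ he
  have h1 : 𝓗.src b = 𝓗.src b' := by
    have := congrArg 𝓗.src he
    exact (𝓗.src_comp a b hab).symm.trans (this.trans (𝓗.src_comp a' b' hab'))
  have h2 : 𝓗.rng a = 𝓗.rng a' := by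
    have := congrArg 𝓗.rng he
    exact (𝓗.rng_comp a b hab).symm.trans (this.trans (𝓗.rng_comp a' b' hab'))
  exact Subtype.ext (Prod.ext (hfr ha ha' h2) (hgs hb hb' h1))

/-- The product in `⟦𝓗⟧`. -/
def PartialAut.mul {𝓗 : DiscreteBorelGroupoid X H} (f g : 𝓗.PartialAut) : 𝓗.PartialAut :=
  ⟨𝓗.setMul f.1 g.1, f.2.setMul g.2⟩

/-- The unit space, as an element of `⟦𝓗⟧`. -/
def PartialAut.one (𝓗 : DiscreteBorelGroupoid X H) : 𝓗.PartialAut :=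
  ⟨𝓗.units, by
    refine isPartialAut_of_injOn 𝓗 ?_ ?_ ?_
    · have hinj : Function.Injective 𝓗.unit := Function.LeftInverse.injective 𝓗.src_unit
      exact (𝓗.measurable_unit.measurableEmbedding hinj).measurableSet_range
    · rintro _ ⟨x, rfl⟩ _ ⟨y, rfl⟩ h
      rw [𝓗.src_unit, 𝓗.src_unit] at h
      rw [h]
    · rintro _ ⟨x, rfl⟩ _ ⟨y, rfl⟩ h
      rw [𝓗.rng_unit, 𝓗.rng_unit] at h
      rw [h]⟩

/-- The measure `ν_s(B) = ∫ |s⁻¹(x) ∩ B| dν(x)` on the morphisms. -/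
noncomputable def srcMeasure (𝓗 : DiscreteBorelGroupoid X H) (ν : Measure X)
    [IsFiniteMeasure ν] : Measure H := fiberCount ν 𝓗.src 𝓗.measurable_src

/-- The measure `ν_r(B) = ∫ |r⁻¹(x) ∩ B| dν(x)` on the morphisms. -/
noncomputable def rngMeasure (𝓗 : DiscreteBorelGroupoid X H) (ν : Measure X)
    [IsFiniteMeasure ν] : Measure H := fiberCount ν 𝓗.rng 𝓗.measurable_rng

/-- `(𝓗, ν)` is probability-measure-preserving. The common value of `ν_s` and `ν_r` is the
measure on `𝓗` that is also denoted by `ν`. -/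
def IsPMP (𝓗 : DiscreteBorelGroupoid X H) (ν : Measure X) [IsProbabilityMeasure ν] : Prop :=
  𝓗.srcMeasure ν = 𝓗.rngMeasure ν

end Basic

section Topological

variable {X H : Type*} [MeasurableSpace X] [MeasurableSpace H] [TopologicalSpace X]
  [TopologicalSpace H]

/-- The structure maps are continuous. In particular, `unit` is a homeomorphism from `X` onto the
set of units with the topology of a subspace of `H`. -/
structure IsTopological (𝓗 : DiscreteBorelGroupoid X H) : Prop where
  continuous_src : Continuous 𝓗.src
  continuous_rng : Continuous 𝓗.rng
  continuous_unit : Continuous 𝓗.unit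
  continuous_comp : Continuous 𝓗.compMap
  continuous_inv : Continuous 𝓗.inv

/-- An open set on which the source and range maps are homeomorphisms onto open sets. -/
def IsBisection (𝓗 : DiscreteBorelGroupoid X H) (U : Set H) : Prop :=
  IsOpen U ∧ IsOpenEmbedding (U.domRestrict 𝓗.src) ∧ IsOpenEmbedding (U.domRestrict 𝓗.rng)

/-- Every morphism lies in a bisection. -/
def IsEtale (𝓗 : DiscreteBorelGroupoid X H) : Prop := ∀ h : H, ∃ U, 𝓗.IsBisection U ∧ h ∈ U

/-- The Borel sets whose boundary has measure zero. -/
def NullBoundary (ν : Measure X) (A : Set X) : Prop := MeasurableSet A ∧ ν (frontier A) = 0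

/-- `f ∈ ⟦𝓗⟧_top`. -/
def PartialAut.IsTop {𝓗 : DiscreteBorelGroupoid X H} (ν : Measure X) (f : 𝓗.PartialAut) : Prop :=
  ∃ (n : ℕ) (g : Fin n → Set H),
    f.1 = ⋃ i, g i ∧
    (∀ i, ∃ U, 𝓗.IsBisection U ∧ closure (g i) ⊆ U ∧
      closure (𝓗.src '' g i) ⊆ 𝓗.src '' U ∧ closure (𝓗.rng '' g i) ⊆ 𝓗.rng '' U) ∧
    (∀ i, NullBoundary ν (𝓗.src '' g i)) ∧
    Pairwise (fun i j => Disjoint (𝓗.src '' g i) (𝓗.src '' g j)) ∧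
    (∀ i, NullBoundary ν (𝓗.rng '' g i)) ∧
    Pairwise (fun i j => Disjoint (𝓗.rng '' g i) (𝓗.rng '' g j))

end Topological

end DiscreteBorelGroupoid

open DiscreteBorelGroupoid

/-- The full groupoid on `d` points; `(i, j)` has source `j` and range `i`. -/
def fullGroupoid (d : ℕ) : DiscreteBorelGroupoid (Fin d) (Fin d × Fin d) where
  src := Prod.snd
  rng := Prod.fst
  unit i := (i, i)
  comp f g _ := (f.1, g.2)
  inv := Prod.swap
  src_unit _ := rfl
  rng_unit _ := rfl
  src_comp _ _ _ := rfl
  rng_comp _ _ _ := rfl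
  comp_assoc _ _ _ _ _ := rfl
  unit_comp _ := rfl
  comp_unit _ := rfl
  src_inv _ := rfl
  rng_inv _ := rfl
  inv_comp _ := rfl
  comp_inv _ := rfl
  measurable_src := measurable_snd
  measurable_rng := measurable_fst
  measurable_unit := measurable_of_finite _
  measurable_comp := measurable_of_finite _
  measurable_inv := measurable_swap
  countable_src _ := Set.to_countable _
  countable_rng _ := Set.to_countable _

/-- The normalized cardinality `|E|_d = |E| / d`. -/
noncomputable def normCard {α : Type*} (d : ℕ) (E : Set α) : ℝ := E.ncard / d

section Sofic

variable {X H : Type*} [MeasurableSpace X] [StandardBorelSpace X] [MeasurableSpace H]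
  [StandardBorelSpace H]

/-- The set `Map(⟦𝓗⟧, ⟦d⟧)`. -/
def SoficMap (𝓗 : DiscreteBorelGroupoid X H) (d : ℕ) : Type _ :=
  𝓗.PartialAut → (fullGroupoid d).PartialAut

/-- The Borel structure on `Map(⟦𝓗⟧, ⟦d⟧)`, generated by the sets of all maps which agree with a
given map on a given finite set. -/
instance (𝓗 : DiscreteBorelGroupoid X H) (d : ℕ) : MeasurableSpace (SoficMap 𝓗 d) :=
  MeasurableSpace.generateFrom
    {N | ∃ (σ : SoficMap 𝓗 d) (F : Finset 𝓗.PartialAut), N = {σ' | ∀ f ∈ F, σ' f = σ f}}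

open scoped symmDiff

namespace SoficMap

variable {𝓗 : DiscreteBorelGroupoid X H} {d : ℕ}

/-- `(F, δ)`-multiplicativity. -/
def IsMultiplicative (σ : SoficMap 𝓗 d) (F : Finset 𝓗.PartialAut) (δ : ℝ) : Prop :=
  ∀ s ∈ F, ∀ t ∈ F,
    normCard d ((σ (s.mul t)).1 ∆ (fullGroupoid d).setMul (σ s).1 (σ t).1) < δ

/-- `(F, δ)`-trace-preservation; the trace of a partial automorphism is the measure of its
intersection with the set of units. -/
def IsTracePreserving (ν : Measure X) [IsFiniteMeasure ν] (σ : SoficMap 𝓗 d)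
    (F : Finset 𝓗.PartialAut) (δ : ℝ) : Prop :=
  ∀ s ∈ F, |normCard d ((fullGroupoid d).units ∩ (σ s).1) -
    (𝓗.srcMeasure ν).real (𝓗.units ∩ s.1)| < δ

/-- `(F, δ)`-continuity. -/
def IsContinuous (ν : Measure X) [IsFiniteMeasure ν] (σ : SoficMap 𝓗 d)
    (F : Finset 𝓗.PartialAut) (δ : ℝ) : Prop :=
  ∀ f ∈ F, ∀ g ∈ F,
    normCard d ((σ f).1 ∆ (σ g).1) < δ + (𝓗.srcMeasure ν).real (f.1 ∆ g.1)

end SoficMap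

variable {J : Type*} [Preorder J]

/-- `ℙ` is a sofic approximation to `(𝓗, ν)`. -/
structure IsSoficApproximation (𝓗 : DiscreteBorelGroupoid X H) (ν : Measure X)
    [IsFiniteMeasure ν] (d : J → ℕ) (ℙ : ∀ j, Measure (SoficMap 𝓗 (d j))) : Prop where
  isProbabilityMeasure : ∀ j, IsProbabilityMeasure (ℙ j)
  tracePreserving : ∀ (F : Finset 𝓗.PartialAut) (δ : ℝ), 0 < δ →
    Tendsto (fun j => ℙ j {σ | σ.IsTracePreserving ν F δ}) atTop (𝓝 1)
  multiplicative : ∀ (F : Finset 𝓗.PartialAut) (δ : ℝ), 0 < δ →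
    ∃ j, ∀ j' ≥ j, ∀ᵐ σ ∂(ℙ j'), σ.IsMultiplicative F δ
  tendsto_atTop : Tendsto d atTop atTop
  ae_eq : ∀ f f' : 𝓗.PartialAut, 𝓗.srcMeasure ν (f.1 ∆ f'.1) = 0 →
    ∀ j, ∀ᵐ σ ∂(ℙ j), σ f = σ f'

/-- `ℙ` is asymptotically continuous. -/
def IsAsymptoticallyContinuous (𝓗 : DiscreteBorelGroupoid X H) (ν : Measure X)
    [IsFiniteMeasure ν] (d : J → ℕ) (ℙ : ∀ j, Measure (SoficMap 𝓗 (d j))) : Prop :=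
  ∀ (F : Finset 𝓗.PartialAut) (δ : ℝ), 0 < δ →
    ∃ j, ∀ j' ≥ j, ∀ᵐ σ ∂(ℙ j'), σ.IsContinuous ν F δ

/-- A bias for `J`: `-`, `+` or an ultrafilter on `J` containing all the sets `{j' | j ≤ j'}`. -/
inductive Bias (J : Type*) [Preorder J]
  | minus : Bias J
  | plus : Bias J
  | ultrafilter (β : Ultrafilter J) (hβ : ∀ j : J, Ici j ∈ β) : Bias J

/-- The limit along a bias. An ultralimit always exists in the compact space of extended reals. -/
noncomputable def Bias.lim : Bias J → (J → EReal) → EReal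
  | .minus, Φ => liminf Φ atTop
  | .plus, Φ => limsup Φ atTop
  | .ultrafilter β _, Φ => limUnder (β : Filter J) Φ

end Sofic

/-- A class-bijective extension `π : 𝓖 → 𝓗`: a surjective Borel groupoid morphism which is
bijective on source fibres and on range fibres. The induced map on units is `obj`. -/
structure ClassBijectiveExtension {Y G X H : Type*} [MeasurableSpace Y] [MeasurableSpace G]
    [MeasurableSpace X] [MeasurableSpace H] (𝓖 : DiscreteBorelGroupoid Y G)
    (𝓗 : DiscreteBorelGroupoid X H) where
  toFun : G → H
  obj : Y → X
  map_unit : ∀ y, toFun (𝓖.unit y) = 𝓗.unit (obj y)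
  src_map : ∀ g, 𝓗.src (toFun g) = obj (𝓖.src g)
  rng_map : ∀ g, 𝓗.rng (toFun g) = obj (𝓖.rng g)
  map_comp : ∀ (f g : G) (h : 𝓖.src f = 𝓖.rng g), toFun (𝓖.comp f g h) =
    𝓗.comp (toFun f) (toFun g) ((src_map f).trans ((congrArg obj h).trans (rng_map g).symm))
  map_inv : ∀ g, toFun (𝓖.inv g) = 𝓗.inv (toFun g)
  measurable_toFun : Measurable toFun
  bijOn_src : ∀ y, BijOn toFun (𝓖.src ⁻¹' {y}) (𝓗.src ⁻¹' {obj y})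
  bijOn_rng : ∀ y, BijOn toFun (𝓖.rng ⁻¹' {y}) (𝓗.rng ⁻¹' {obj y})
  surjective : Function.Surjective toFun

/-- A finite partition of `Y` into nonempty sets. -/
structure FinitePartition (Y : Type*) where
  parts : Finset (Set Y)
  isPartition : Setoid.IsPartition (parts : Set (Set Y))

namespace FinitePartition

variable {Y : Type*}

/-- All parts are Borel. -/
def IsBorel [MeasurableSpace Y] (𝔓 : FinitePartition Y) : Prop :=
  ∀ A ∈ 𝔓.parts, MeasurableSet A

/-- `𝔔 ≤ 𝔓`: the partition `𝔓` refines `𝔔`. -/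
def Coarser (𝔔 𝔓 : FinitePartition Y) : Prop := ∀ P ∈ 𝔓.parts, ∃ Q ∈ 𝔔.parts, P ⊆ Q

/-- The smallest sigma-algebra `Σ(𝔓)` containing the parts. -/
abbrev sigma (𝔓 : FinitePartition Y) : MeasurableSpace Y :=
  MeasurableSpace.generateFrom (𝔓.parts : Set (Set Y))

/-- The coarsest partition for which every member of a finite family `𝓒` of sets is a union of
parts: two points are in the same part if they are in the same members of `𝓒`. -/
def cellSetoid (𝓒 : Finset (Set Y)) : Setoid Y where
  r x y := ∀ A ∈ 𝓒, (x ∈ A ↔ y ∈ A)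
  iseqv :=
    { refl := fun _ _ _ => Iff.rfl
      symm := fun h A hA => (h A hA).symm
      trans := fun h k A hA => (h A hA).trans (k A hA) }

theorem finite_classes_cellSetoid (𝓒 : Finset (Set Y)) : (cellSetoid 𝓒).classes.Finite := by
  classical
  refine ((𝓒.powerset : Set (Finset (Set Y))).toFinite.image
    fun T => {x : Y | ∀ A ∈ 𝓒, (x ∈ A ↔ A ∈ T)}).subset ?_
  rintro _ ⟨y, rfl⟩
  refine ⟨𝓒.filter fun A => y ∈ A, Finset.mem_powerset.2 (Finset.filter_subset _ _), ?_⟩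
  ext x
  refine forall₂_congr fun A hA => ?_
  simp [hA]

/-- The partition generated by a finite family of sets. -/
noncomputable def generated (𝓒 : Finset (Set Y)) : FinitePartition Y where
  parts := (finite_classes_cellSetoid 𝓒).toFinset
  isPartition := by
    rw [Set.Finite.coe_toFinset]
    exact Setoid.isPartition_classes _

theorem measurableSet_sigma_part (𝔓 : FinitePartition Y) {A : Set Y} (hA : A ∈ 𝔓.parts) :
    MeasurableSet[𝔓.sigma] A :=
  MeasurableSpace.measurableSet_generateFrom hA

theorem measurableSet_sigma_generated {𝓒 : Finset (Set Y)} {A : Set Y} (hA : A ∈ 𝓒) :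
    MeasurableSet[(generated 𝓒).sigma] A := by
  have h : A = ⋃₀ {B | B ∈ (generated 𝓒).parts ∧ B ⊆ A} := by
    ext x
    constructor
    · intro hx
      refine ⟨{y | (cellSetoid 𝓒).r y x}, ⟨?_, fun y hy => (hy A hA).2 hx⟩,
        (cellSetoid 𝓒).refl x⟩
      exact (Set.Finite.mem_toFinset _).2 ⟨x, rfl⟩
    · rintro ⟨B, ⟨-, hB⟩, hx⟩
      exact hB hx
  rw [h]
  refine MeasurableSet.sUnion (((generated 𝓒).parts.finite_toSet.subset fun B hB => hB.1).countable)
    fun B hB => measurableSet_sigma_part _ hB.1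

theorem sigma_le_of_coarser {𝔔 𝔓 : FinitePartition Y} (h : 𝔔.Coarser 𝔓) : 𝔔.sigma ≤ 𝔓.sigma := by
  refine MeasurableSpace.generateFrom_le fun Q hQ => ?_
  have hU : Q = ⋃₀ {P | P ∈ 𝔓.parts ∧ P ⊆ Q} := by
    ext x
    constructor
    · intro hx
      obtain ⟨P, ⟨hP, hxP⟩, -⟩ := 𝔓.isPartition.2 x
      obtain ⟨Q', hQ', hPQ'⟩ := h P hP
      have : Q' = Q := (𝔔.isPartition.2 x).unique ⟨hQ', hPQ' hxP⟩ ⟨hQ, hx⟩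
      exact ⟨P, ⟨hP, this ▸ hPQ'⟩, hxP⟩
    · rintro ⟨P, ⟨-, hP⟩, hx⟩
      exact hP hx
  rw [hU]
  exact MeasurableSet.sUnion ((𝔓.parts.finite_toSet.subset fun B hB => hB.1).countable)
    fun B hB => measurableSet_sigma_part _ hB.1

end FinitePartition

section Entropy

variable {Y G X H : Type*} [MeasurableSpace Y] [MeasurableSpace G] [MeasurableSpace X]
  [StandardBorelSpace X] [MeasurableSpace H] [StandardBorelSpace H]
  {𝓖 : DiscreteBorelGroupoid Y G} {𝓗 : DiscreteBorelGroupoid X H}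

/-- `f · P` for a partial automorphism `f` of the factor and a set `P` of units of the
extension. -/
def ClassBijectiveExtension.act (π : ClassBijectiveExtension 𝓖 𝓗) (f : 𝓗.PartialAut)
    (P : Set Y) : Set Y := 𝓖.act (π.toFun ⁻¹' f.1) P

theorem ClassBijectiveExtension.act_one (π : ClassBijectiveExtension 𝓖 𝓗) (P : Set Y) :
    π.act (PartialAut.one 𝓗) P = P := by
  have hunit : ∀ g : G, π.toFun g ∈ 𝓗.units → g = 𝓖.unit (𝓖.src g) := by
    rintro g ⟨x, hx⟩
    refine (π.bijOn_src (𝓖.src g)).injOn rfl (𝓖.src_unit _) ?_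
    rw [π.map_unit, ← hx, ← π.src_map, ← hx, 𝓗.src_unit]
  ext y
  constructor
  · rintro ⟨g, ⟨hg, hP⟩, rfl⟩
    have := hunit g hg
    have hr : 𝓖.rng g = 𝓖.src g := by
      rw [this, 𝓖.rng_unit, 𝓖.src_unit]
    rw [hr]
    exact hP
  · intro hy
    refine ⟨𝓖.unit y, ⟨⟨π.obj y, (π.map_unit y).symm⟩, ?_⟩, 𝓖.rng_unit y⟩
    rw [mem_preimage, 𝓖.src_unit]
    exact hy

open Classical in
/-- The partition `𝔓^F`: the coarsest partition such that every `f · P` with `f ∈ F` and `P ∈ 𝔓`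
is a union of parts. -/
noncomputable def FinitePartition.dyn (𝔓 : FinitePartition Y) (π : ClassBijectiveExtension 𝓖 𝓗)
    (F : Finset 𝓗.PartialAut) : FinitePartition Y :=
  FinitePartition.generated ((F ×ˢ 𝔓.parts).image fun q => π.act q.1 q.2)

namespace FinitePartition

theorem measurableSet_dyn_act {𝔓 : FinitePartition Y} {π : ClassBijectiveExtension 𝓖 𝓗}
    {F : Finset 𝓗.PartialAut} {f : 𝓗.PartialAut} (hf : f ∈ F) {P : Set Y} (hP : P ∈ 𝔓.parts) :
    MeasurableSet[(𝔓.dyn π F).sigma] (π.act f P) := by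
  classical
  exact measurableSet_sigma_generated
    (Finset.mem_image.2 ⟨(f, P), Finset.mem_product.2 ⟨hf, hP⟩, rfl⟩)

theorem sigma_le_dyn {𝔓 : FinitePartition Y} {π : ClassBijectiveExtension 𝓖 𝓗}
    {F : Finset 𝓗.PartialAut} (hF : PartialAut.one 𝓗 ∈ F) : 𝔓.sigma ≤ (𝔓.dyn π F).sigma := by
  refine MeasurableSpace.generateFrom_le fun P hP => ?_
  have := measurableSet_dyn_act (π := π) hF hP
  rwa [π.act_one] at this

end FinitePartition

/-- A homomorphism from the algebra of measurable sets of `m` to the algebra of all subsets of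
`Fin d`. -/
structure IsHom {d : ℕ} (m : MeasurableSpace Y)
    (φ : {A : Set Y // MeasurableSet[m] A} → Set (Fin d)) : Prop where
  map_union : ∀ A B, φ ⟨A.1 ∪ B.1, A.2.union B.2⟩ = φ A ∪ φ B
  map_inter : ∀ A B, φ ⟨A.1 ∩ B.1, A.2.inter B.2⟩ = φ A ∩ φ B
  map_empty : φ ⟨∅, @MeasurableSet.empty _ m⟩ = ∅
  map_univ : φ ⟨univ, @MeasurableSet.univ _ m⟩ = univ

open scoped symmDiff

/-- The set `Hom(π, σ, 𝔓, F, δ)` of good homomorphisms `Σ(𝔓^F) → {subsets of Fin d}`, for `F`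
containing the unit space. -/
def goodHoms (π : ClassBijectiveExtension 𝓖 𝓗) (μ : Measure Y) {d : ℕ} (σ : SoficMap 𝓗 d)
    (𝔓 : FinitePartition Y) (F : Finset 𝓗.PartialAut) (hF : PartialAut.one 𝓗 ∈ F) (δ : ℝ) :
    Set ({A : Set Y // MeasurableSet[(𝔓.dyn π F).sigma] A} → Set (Fin d)) :=
  {φ | IsHom _ φ ∧
    (∀ (f : 𝓗.PartialAut) (hf : f ∈ F),
      ∑ P : 𝔓.parts, normCard d
        ((fullGroupoid d).act (σ f).1
            (φ ⟨P.1, FinitePartition.sigma_le_dyn hF P.1 (𝔓.measurableSet_sigma_part P.2)⟩) ∆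
          φ ⟨π.act f P.1, FinitePartition.measurableSet_dyn_act hf P.2⟩) < δ) ∧
    ∑ P : (𝔓.dyn π F).parts,
      |normCard d (φ ⟨P.1, (𝔓.dyn π F).measurableSet_sigma_part P.2⟩) - μ.real P.1| < δ}

/-- `|Hom(π, σ, 𝔓, F, δ)|_𝔔`, the number of restrictions to `Σ(𝔔)` of good homomorphisms. -/
noncomputable def goodHomsCard (π : ClassBijectiveExtension 𝓖 𝓗) (μ : Measure Y) {d : ℕ}
    (σ : SoficMap 𝓗 d) {𝔔 𝔓 : FinitePartition Y} (hQ : 𝔔.Coarser 𝔓) (F : Finset 𝓗.PartialAut)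
    (hF : PartialAut.one 𝓗 ∈ F) (δ : ℝ) : ℕ∞ :=
  ((fun (φ : {A : Set Y // MeasurableSet[(𝔓.dyn π F).sigma] A} → Set (Fin d))
      (A : {A : Set Y // MeasurableSet[𝔔.sigma] A}) =>
        φ ⟨A.1, FinitePartition.sigma_le_dyn hF A.1
          (FinitePartition.sigma_le_of_coarser hQ A.1 A.2)⟩) ''
    goodHoms π μ σ 𝔓 F hF δ).encard

variable {J : Type*} [Preorder J]

/-- `h_{ℙ,μ}(π, 𝔔, 𝔓, F, δ)`, the limit along the bias `β` of
`d_j⁻¹ log ‖ |Hom(π, ·, 𝔓, F, δ)|_𝔔 ‖_{p, ℙ_j}`, where `log 0 = -∞`. -/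
noncomputable def entropyAt (d : J → ℕ) (ℙ : ∀ j, Measure (SoficMap 𝓗 (d j))) (p : ℝ≥0∞)
    (β : Bias J) (π : ClassBijectiveExtension 𝓖 𝓗) (μ : Measure Y) {𝔔 𝔓 : FinitePartition Y}
    (hQ : 𝔔.Coarser 𝔓) (F : Finset 𝓗.PartialAut) (hF : PartialAut.one 𝓗 ∈ F) (δ : ℝ) : EReal :=
  β.lim fun j => (((d j : ℝ)⁻¹ : ℝ) : EReal) * ENNReal.log
    (eLpNorm (fun σ => (goodHomsCard π μ σ hQ F hF δ : ℝ≥0∞)) p (ℙ j))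

/-- `h_{ℙ,μ}(π, 𝔔, 𝔓)`, the infimum over all finite `F ⊆ ⟦𝓗⟧` containing the unit space and all
`δ > 0`. -/
noncomputable def entropy (d : J → ℕ) (ℙ : ∀ j, Measure (SoficMap 𝓗 (d j))) (p : ℝ≥0∞)
    (β : Bias J) (π : ClassBijectiveExtension 𝓖 𝓗) (μ : Measure Y) {𝔔 𝔓 : FinitePartition Y}
    (hQ : 𝔔.Coarser 𝔓) : EReal :=
  ⨅ (F : Finset 𝓗.PartialAut) (hF : PartialAut.one 𝓗 ∈ F) (δ : ℝ) (_ : 0 < δ),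
    entropyAt d ℙ p β π μ hQ F hF δ

end Entropy

end SoficEntropy

/-! Shrinking the family of admissible `F` can only increase the infimum, so the content is the
converse: every pair `(F, δ)` is dominated by a pair `(F', δ')` with `F'` in `⟦𝓗⟧_top`.

Density. Each `f` is within small `ν`-measure of some `f'` in `⟦𝓗⟧_top`
(`exists_isTop_symmDiff_le`). By regularity, `f` is almost exhausted by a compact `K`, and `K` lies
in an open `V` of nearly the same measure. Finitely many small bisections inside `V` with null
boundaries cover `K`; a greedy choice makes their sources and their ranges disjoint. What the greedy
choice loses from `K` shares a source or a range with some point of the result outside `K`, hence is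
small. Cutting down by ranges keeps null boundaries of sources because a pmp partial homeomorphism
carries null boundaries to null boundaries (`NullBoundary.transfer`).

Transfer of homomorphisms. If `f'` is close to `f`, asymptotic continuity makes `σ_f` and `σ_{f'}`
close for almost every `σ`, and class-bijectivity gives `μ(f·P ∆ f'·P) ≤ ν(f ∆ f')`
(`measure_act_symmDiff_le`). A good homomorphism for `F'` is, however, defined only on `Σ(𝔓^{F'})`.
It amounts to a labelling of `Fin d` by parts, and the labels are lifted to the parts of the common
refinement `𝔓^{F ∪ F'}` with frequencies close to `μ`, up to a rounding error of order `1/d`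
(`exists_lift_sum_abs_sub_le`). Restricting to `Σ(𝔓^F)` gives a good homomorphism for `F` with
unchanged values on `Σ(𝔓)`, so the number of restrictions to `Σ(𝔔)` for `F'` is at most that for `F`
(`goodHomsCard_le_of_approx`).

The comparison holds for almost every `σ` once `d_j` is large, hence for every `L^p` norm and every
bias. -/

namespace SoficEntropy

set_option linter.unusedSectionVars false

open scoped symmDiff
open DiscreteBorelGroupoid

/-! ### Normalized counting and lifting of labels -/

section Counting

theorem normCard_mono {α : Type*} [Finite α] (d : ℕ) {A B : Set α} (h : A ⊆ B) :
    normCard d A ≤ normCard d B := by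
  unfold normCard
  gcongr
  exact B.toFinite

theorem normCard_union_le {α : Type*} (d : ℕ) (A B : Set α) :
    normCard d (A ∪ B) ≤ normCard d A + normCard d B := by
  unfold normCard
  rw [← add_div]
  gcongr
  exact_mod_cast ncard_union_le A B

theorem normCard_symmDiff_triangle {α : Type*} [Finite α] (d : ℕ) (A B C : Set α) :
    normCard d (A ∆ C) ≤ normCard d (A ∆ B) + normCard d (B ∆ C) :=
  (normCard_mono d (symmDiff_triangle A B C)).trans (normCard_union_le d _ _)

/-- The frequencies of the labels in a set add up to the frequency of the set. -/
theorem normCard_label_mem_eq_sum {ι U : Type*} [Finite U] (d : ℕ) (b : U → ι) (T : Finset ι) :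
    normCard d {u | b u ∈ T} = ∑ i ∈ T, normCard d {u | b u = i} := by
  classical
  have := Fintype.ofFinite U
  unfold normCard
  rw [← Finset.sum_div]
  congr 1
  rw [ncard_eq_toFinset_card', Finset.card_eq_sum_card_fiberwise (f := b) (t := T)]
  · push_cast
    refine Finset.sum_congr rfl fun i hi => ?_
    rw [ncard_eq_toFinset_card']
    congr 2
    ext u
    simp only [toFinset_ofPred, Finset.mem_filter, Finset.mem_univ, true_and]
    constructor
    · exact fun h => h.2
    · rintro rfl
      exact ⟨hi, rfl⟩
  · intro u hu
    simpa using hu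

/-- Labels in `α` can be lifted along `q : ι → α` so that in every fibre of `q` the counts exceed
the targets `t` by at most one, or are all at least the targets. -/
theorem exists_lift_card_fiber {ι α U : Type*} [DecidableEq ι] (q : ι → α)
    (hq : Function.Surjective q) (t : ι → ℝ) (ht : ∀ i, 0 ≤ t i) (a : U → α) (s : Finset U) :
    ∃ b : U → ι, (∀ u, q (b u) = a u) ∧ ∀ x,
      (∀ i, q i = x → (((s.filter fun u => b u = i).card : ℕ) : ℝ) ≤ t i + 1) ∨
      (∀ i, q i = x → t i ≤ ((s.filter fun u => b u = i).card : ℕ)) := by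
  classical
  induction s using Finset.induction_on with
  | empty =>
    choose b hb using fun u => hq (a u)
    refine ⟨b, hb, fun x => Or.inl fun i _ => ?_⟩
    simp only [Finset.filter_empty, Finset.card_empty, Nat.cast_zero]
    linarith [ht i]
  | insert u s hu ih =>
    obtain ⟨b, hb, h⟩ := ih
    have hcount : ∀ i₀ i, (((insert u s).filter fun v => Function.update b u i₀ v = i).card : ℕ) =
        (s.filter fun v => b v = i).card + if i₀ = i then 1 else 0 := by
      intro i₀ i
      have h1 : (s.filter fun v => Function.update b u i₀ v = i) = s.filter fun v => b v = i := by
        refine Finset.filter_congr fun v hv => ?_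
        rw [Function.update_of_ne (fun e : v = u => hu (e ▸ hv))]
      rw [Finset.filter_insert, Function.update_self, h1]
      split_ifs with hi
      · rw [Finset.card_insert_of_notMem fun e => hu (Finset.mem_filter.1 e).1]
      · rfl
    have hlift : ∀ i₀, q i₀ = a u → ∀ v, q (Function.update b u i₀ v) = a v := by
      intro i₀ hi₀ v
      rcases eq_or_ne v u with rfl | hv
      · rwa [Function.update_self]
      · rw [Function.update_of_ne hv, hb]
    -- Greedy choice: the new point goes to a label of its fibre that is still below target, if
    -- there is one, so no count passes its target by more than one. If there is none, the whole
    -- fibre has reached its targets and any label will do.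
    by_cases hlow : ∃ i₀, q i₀ = a u ∧ (((s.filter fun v => b v = i₀).card : ℕ) : ℝ) < t i₀
    · obtain ⟨i₀, hi₀, hlt⟩ := hlow
      refine ⟨Function.update b u i₀, hlift i₀ hi₀, fun x => ?_⟩
      simp only [hcount]
      push_cast
      rcases eq_or_ne x (a u) with rfl | hx
      · left
        intro i hi
        split_ifs with he
        · subst he; linarith
        · rcases h (a u) with h | h
          · simpa using h i hi
          · exact absurd (h i₀ hi₀) (not_le.2 hlt)
      · have hne : ∀ i, q i = x → i₀ ≠ i := by
          rintro i hi rfl; exact hx (hi.symm.trans hi₀)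
        refine (h x).imp (fun h i hi => ?_) (fun h i hi => ?_)
        · rw [if_neg (hne i hi)]; simpa using h i hi
        · rw [if_neg (hne i hi)]; simpa using h i hi
    · push Not at hlow
      obtain ⟨i₀, hi₀⟩ := hq (a u)
      refine ⟨Function.update b u i₀, hlift i₀ hi₀, fun x => ?_⟩
      simp only [hcount]
      push_cast
      rcases eq_or_ne x (a u) with rfl | hx
      · right
        intro i hi
        have := hlow i hi
        split_ifs <;> linarith
      · have hne : ∀ i, q i = x → i₀ ≠ i := by
          rintro i hi rfl; exact hx (hi.symm.trans hi₀)
        refine (h x).imp (fun h i hi => ?_) (fun h i hi => ?_)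
        · rw [if_neg (hne i hi)]; simpa using h i hi
        · rw [if_neg (hne i hi)]; simpa using h i hi

/-- Labels whose frequencies are close to the pushforward of a weight `w` along `q` can be lifted
to labels whose frequencies are close to `w`. -/
theorem exists_lift_sum_abs_sub_le {ι α : Type*} [Fintype ι] [Fintype α] [DecidableEq α]
    (q : ι → α) (hq : Function.Surjective q) (w : ι → ℝ) (hw : ∀ i, 0 ≤ w i) {d : ℕ} (hd : 0 < d)
    (a : Fin d → α) :
    ∃ b : Fin d → ι, (∀ u, q (b u) = a u) ∧
      ∑ i, |normCard d {u | b u = i} - w i| ≤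
        ∑ x, |normCard d {u | a u = x} - ∑ i with q i = x, w i| +
          2 * (Fintype.card ι : ℝ) / d := by
  classical
  have hd' : (0 : ℝ) < d := Nat.cast_pos.2 hd
  obtain ⟨b, hb, h⟩ := exists_lift_card_fiber q hq (fun i => d * w i)
    (fun i => mul_nonneg hd'.le (hw i)) a Finset.univ
  refine ⟨b, hb, ?_⟩
  have hk : ∀ i, (((Finset.univ.filter fun u => b u = i).card : ℕ) : ℝ) =
      d * normCard d {u | b u = i} := by
    intro i
    rw [normCard, ncard_eq_toFinset_card', toFinset_ofPred]
    field_simp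
  simp only [hk] at h
  have hfib : ∀ x, normCard d {u | a u = x} = ∑ i with q i = x, normCard d {u | b u = i} := by
    intro x
    rw [← normCard_label_mem_eq_sum]
    congr 1
    ext u
    simp [hb]
  have key : ∀ x, ∑ i with q i = x, |normCard d {u | b u = i} - w i| ≤
      |normCard d {u | a u = x} - ∑ i with q i = x, w i| + ∑ i with q i = x, 2 / (d : ℝ) := by
    intro x
    rw [hfib x, ← Finset.sum_sub_distrib]
    rcases h x with h | h
    -- Here every difference `x` of frequency and weight is at most `1 / d`, so `|x| ≤ -x + 2 / d`,
    -- and the sum of the `-x` is at most the deviation of the fibre. In the other case all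
    -- differences are nonnegative and nothing is lost.
    · refine le_trans ?_ (add_le_add_left (neg_le_abs _) _)
      rw [← Finset.sum_neg_distrib, ← Finset.sum_add_distrib]
      refine Finset.sum_le_sum fun i hi => ?_
      have h1 := h i (Finset.mem_filter.1 hi).2
      have h2 : normCard d {u | b u = i} - w i ≤ 1 / d := by
        rw [le_div_iff₀ hd']; linarith
      have h3 : 2 / (d : ℝ) = 1 / d + 1 / d := by ring
      have h4 : 0 < 1 / (d : ℝ) := by positivity
      rw [abs_le]
      constructor <;> linarith
    · refine le_trans ?_ ((le_abs_self _).trans (le_add_of_nonneg_right (by positivity)))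
      refine Finset.sum_le_sum fun i hi => ?_
      have h1 := h i (Finset.mem_filter.1 hi).2
      rw [abs_of_nonneg (sub_nonneg.2 (le_of_mul_le_mul_left h1 hd'))]
  calc ∑ i, |normCard d {u | b u = i} - w i|
      = ∑ x, ∑ i with q i = x, |normCard d {u | b u = i} - w i| :=
        (Finset.sum_fiberwise _ _ _).symm
    _ ≤ ∑ x, (|normCard d {u | a u = x} - ∑ i with q i = x, w i| +
          ∑ i with q i = x, 2 / (d : ℝ)) := Finset.sum_le_sum fun x _ => key x
    _ = _ := by
        rw [Finset.sum_add_distrib, Finset.sum_fiberwise]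
        simp only [Finset.sum_const, Finset.card_univ, nsmul_eq_mul]
        ring

end Counting

/-! ### Finite partitions and their algebras -/

namespace FinitePartition

variable {Y : Type*}

theorem part_nonempty (𝔓 : FinitePartition Y) {P : Set Y} (hP : P ∈ 𝔓.parts) : P.Nonempty :=
  nonempty_iff_ne_empty.2 fun h => 𝔓.isPartition.1 (h ▸ hP)

theorem eq_of_mem_of_mem (𝔓 : FinitePartition Y) {P Q : Set Y} (hP : P ∈ 𝔓.parts)
    (hQ : Q ∈ 𝔓.parts) {y : Y} (hyP : y ∈ P) (hyQ : y ∈ Q) : P = Q :=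
  (𝔓.isPartition.2 y).unique ⟨hP, hyP⟩ ⟨hQ, hyQ⟩

theorem exists_part_mem (𝔓 : FinitePartition Y) (y : Y) : ∃ P ∈ 𝔓.parts, y ∈ P :=
  let ⟨P, hP, _⟩ := 𝔓.isPartition.2 y
  ⟨P, hP.1, hP.2⟩

/-- The parts are the atoms of `Σ(𝔓)`: the sets that do not split a given part form a σ-algebra
containing all parts. -/
theorem mem_iff_mem_of_measurableSet_sigma (𝔓 : FinitePartition Y) {P A : Set Y}
    (hP : P ∈ 𝔓.parts) (hA : MeasurableSet[𝔓.sigma] A) {x y : Y} (hx : x ∈ P) (hy : y ∈ P) :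
    x ∈ A ↔ y ∈ A := by
  induction A, hA using MeasurableSpace.generateFrom_induction with
  | hC t ht _ =>
    exact ⟨fun h => 𝔓.eq_of_mem_of_mem ht hP h hx ▸ hy, fun h => 𝔓.eq_of_mem_of_mem ht hP h hy ▸ hx⟩
  | empty => exact Iff.rfl
  | compl t _ ih => exact not_congr ih
  | iUnion s _ ih => simp only [mem_iUnion, ih]

theorem generated_coarser {𝓒 𝓓 : Finset (Set Y)} (h : 𝓒 ⊆ 𝓓) :
    (generated 𝓒).Coarser (generated 𝓓) := by
  intro P hP
  obtain ⟨y, rfl⟩ := (Set.Finite.mem_toFinset _).1 hP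
  exact ⟨_, (Set.Finite.mem_toFinset _).2 ⟨y, rfl⟩, fun x hx A hA => hx A (h hA)⟩

theorem isBorel_generated [MeasurableSpace Y] {𝓒 : Finset (Set Y)}
    (h : ∀ A ∈ 𝓒, MeasurableSet A) : (generated 𝓒).IsBorel := by
  intro P hP
  obtain ⟨y, rfl⟩ := (Set.Finite.mem_toFinset _).1 hP
  have : {x | (cellSetoid 𝓒).r x y} = ⋂ A ∈ 𝓒, {x | x ∈ A ↔ y ∈ A} := by
    ext x
    simp only [mem_iInter]
    exact Iff.rfl
  change MeasurableSet {x | (cellSetoid 𝓒).r x y}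
  rw [this]
  refine Finset.measurableSet_biInter _ fun A hA => ?_
  by_cases hy : y ∈ A
  · simpa [hy] using h A hA
  · have hc : {x | x ∈ A ↔ y ∈ A} = Aᶜ := by
      ext x
      simp [hy]
    rw [hc]
    exact (h A hA).compl

theorem IsBorel.measurableSet [MeasurableSpace Y] {𝔓 : FinitePartition Y} (h : 𝔓.IsBorel)
    {A : Set Y} (hA : MeasurableSet[𝔓.sigma] A) : MeasurableSet A :=
  MeasurableSpace.generateFrom_le (s := (𝔓.parts : Set (Set Y))) h A hA

open Classical in
/-- A set of `Σ(𝔓)` is the union of the parts which it contains. -/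
theorem eq_biUnion_of_measurableSet_sigma (𝔓 : FinitePartition Y) {A : Set Y}
    (hA : MeasurableSet[𝔓.sigma] A) :
    A = ⋃ P ∈ Finset.univ.filter fun P : 𝔓.parts => P.1 ⊆ A, P.1 := by
  ext x
  simp only [Finset.mem_filter, Finset.mem_univ, true_and, mem_iUnion, exists_prop]
  constructor
  · intro hx
    obtain ⟨P, hP, hxP⟩ := 𝔓.exists_part_mem x
    exact ⟨⟨P, hP⟩, fun y hy => (𝔓.mem_iff_mem_of_measurableSet_sigma hP hA hxP hy).1 hx, hxP⟩
  · rintro ⟨P, hP, hx⟩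
    exact hP hx

open Classical in
theorem measureReal_eq_sum_parts [MeasurableSpace Y] (μ : Measure Y) [IsFiniteMeasure μ]
    {𝔓 : FinitePartition Y} (h𝔓 : 𝔓.IsBorel) {A : Set Y} (hA : MeasurableSet[𝔓.sigma] A) :
    μ.real A = ∑ P : 𝔓.parts with P.1 ⊆ A, μ.real P.1 := by
  conv_lhs => rw [𝔓.eq_biUnion_of_measurableSet_sigma hA]
  refine measureReal_biUnion_finset (fun P _ Q _ hPQ => disjoint_left.2 fun x hxP hxQ =>
    hPQ (Subtype.ext (𝔓.eq_of_mem_of_mem P.2 Q.2 hxP hxQ))) fun P _ => h𝔓 P.1 P.2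

/-- If the parts of `𝔓` label `Fin d` with frequencies close to their measures, then every set in
`Σ(𝔓)` has frequency close to its measure. -/
theorem abs_normCard_sub_measureReal_le [MeasurableSpace Y] (μ : Measure Y) [IsFiniteMeasure μ]
    {𝔓 : FinitePartition Y} (h𝔓 : 𝔓.IsBorel) {d : ℕ} (b : Fin d → 𝔓.parts) {A : Set Y}
    (hA : MeasurableSet[𝔓.sigma] A) :
    |normCard d {u | (b u).1 ⊆ A} - μ.real A| ≤
      ∑ P : 𝔓.parts, |normCard d {u | b u = P} - μ.real P.1| := by
  classical
  have h := normCard_label_mem_eq_sum d b (Finset.univ.filter fun P : 𝔓.parts => P.1 ⊆ A)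
  simp only [Finset.mem_filter, Finset.mem_univ, true_and] at h
  rw [h, measureReal_eq_sum_parts μ h𝔓 hA, ← Finset.sum_sub_distrib]
  exact (Finset.abs_sum_le_sum_abs _ _).trans
    (Finset.sum_le_sum_of_subset_of_nonneg (Finset.filter_subset _ _) fun _ _ _ => abs_nonneg _)

/-- Each part of `𝔔` is a disjoint union of parts of `𝔓`, so the triangle inequality within each
group shows that coarsening does not increase the total deviation. -/
theorem sum_abs_normCard_sub_measureReal_le [MeasurableSpace Y] (μ : Measure Y)
    [IsFiniteMeasure μ] {𝔔 𝔓 : FinitePartition Y} (h𝔓 : 𝔓.IsBorel) (hQ : 𝔔.Coarser 𝔓) {d : ℕ}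
    (b : Fin d → 𝔓.parts) :
    ∑ Q : 𝔔.parts, |normCard d {u | (b u).1 ⊆ Q.1} - μ.real Q.1| ≤
      ∑ P : 𝔓.parts, |normCard d {u | b u = P} - μ.real P.1| := by
  classical
  choose q hq hPq using fun P : 𝔓.parts => hQ P.1 P.2
  have hiff : ∀ (P : 𝔓.parts) (Q : 𝔔.parts), P.1 ⊆ Q.1 ↔ (⟨q P, hq P⟩ : 𝔔.parts) = Q := by
    intro P Q
    constructor
    · intro h
      obtain ⟨y, hy⟩ := 𝔓.part_nonempty P.2
      exact Subtype.ext (𝔔.eq_of_mem_of_mem (hq P) Q.2 (hPq P hy) (h hy))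
    · rintro rfl
      exact hPq P
  rw [← Finset.sum_fiberwise _ (fun P : 𝔓.parts => (⟨q P, hq P⟩ : 𝔔.parts))]
  refine Finset.sum_le_sum fun Q _ => ?_
  have h := normCard_label_mem_eq_sum d b (Finset.univ.filter fun P : 𝔓.parts => P.1 ⊆ Q.1)
  simp only [Finset.mem_filter, Finset.mem_univ, true_and] at h
  rw [h, measureReal_eq_sum_parts μ h𝔓 (sigma_le_of_coarser hQ _ (𝔔.measurableSet_sigma_part Q.2)),
    ← Finset.sum_sub_distrib]
  simp only [hiff]
  exact Finset.abs_sum_le_sum_abs _ _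

end FinitePartition

/-! ### Homomorphisms as labellings -/

/-- A homomorphism on `Σ(𝔓)` is given by a labelling of `Fin d` by the parts of `𝔓`. -/
theorem IsHom.exists_label {Y : Type*} {𝔓 : FinitePartition Y} {d : ℕ}
    {φ : {A : Set Y // MeasurableSet[𝔓.sigma] A} → Set (Fin d)} (hφ : IsHom 𝔓.sigma φ) :
    ∃ a : Fin d → 𝔓.parts, ∀ A u, u ∈ φ A ↔ (a u).1 ⊆ A.1 := by
  classical
  -- Finite unions are preserved, so a point in the image of a union of parts lies in the image of
  -- one of them. Applied to the whole space, this labels every point.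
  have hfin : ∀ T : Finset 𝔓.parts, ∀ h : MeasurableSet[𝔓.sigma] (⋃ P ∈ T, P.1),
      ∀ u ∈ φ ⟨_, h⟩, ∃ P : 𝔓.parts, u ∈ φ ⟨P.1, 𝔓.measurableSet_sigma_part P.2⟩ := by
    intro T
    induction T using Finset.induction_on with
    | empty =>
      intro h u hu
      have : (⟨_, h⟩ : {A : Set Y // MeasurableSet[𝔓.sigma] A}) =
        ⟨∅, @MeasurableSet.empty _ 𝔓.sigma⟩ := Subtype.ext (by simp)
      rw [this, hφ.map_empty] at hu
      exact hu.elim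
    | insert P T _ ih =>
      intro h u hu
      have hT : MeasurableSet[𝔓.sigma] (⋃ P ∈ T, P.1) :=
        Finset.measurableSet_biUnion _ fun P _ => 𝔓.measurableSet_sigma_part P.2
      have : (⟨_, h⟩ : {A : Set Y // MeasurableSet[𝔓.sigma] A}) =
        ⟨P.1 ∪ _, (𝔓.measurableSet_sigma_part P.2).union hT⟩ :=
        Subtype.ext (Finset.set_biUnion_insert _ _ _)
      rw [this, hφ.map_union ⟨P.1, 𝔓.measurableSet_sigma_part P.2⟩ ⟨_, hT⟩] at hu
      rcases hu with hu | hu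
      · exact ⟨P, hu⟩
      · exact ih hT u hu
  have hex : ∀ u, ∃ P : 𝔓.parts, u ∈ φ ⟨P.1, 𝔓.measurableSet_sigma_part P.2⟩ := by
    intro u
    have h1 := 𝔓.eq_biUnion_of_measurableSet_sigma (@MeasurableSet.univ _ 𝔓.sigma)
    have hm := @MeasurableSet.univ _ 𝔓.sigma
    rw [h1] at hm
    refine hfin _ hm u ?_
    have : (⟨_, hm⟩ : {A : Set Y // MeasurableSet[𝔓.sigma] A}) =
        ⟨univ, @MeasurableSet.univ _ 𝔓.sigma⟩ := Subtype.ext h1.symm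
    rw [this, hφ.map_univ]
    trivial
  choose a ha using hex
  refine ⟨a, fun A u => ?_⟩
  have hinter := hφ.map_inter ⟨(a u).1, 𝔓.measurableSet_sigma_part (a u).2⟩ A
  constructor
  · intro hu y hy
    by_contra hyA
    have hemp : (a u).1 ∩ A.1 = ∅ := by
      rw [← disjoint_iff_inter_eq_empty, disjoint_left]
      intro z hz hzA
      exact hyA ((𝔓.mem_iff_mem_of_measurableSet_sigma (a u).2 A.2 hz hy).1 hzA)
    have hmem : u ∈ φ ⟨(a u).1 ∩ A.1, (𝔓.measurableSet_sigma_part (a u).2).inter A.2⟩ :=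
      hinter ▸ ⟨ha u, hu⟩
    have : (⟨_, (𝔓.measurableSet_sigma_part (a u).2).inter A.2⟩ :
        {A : Set Y // MeasurableSet[𝔓.sigma] A}) = ⟨∅, @MeasurableSet.empty _ 𝔓.sigma⟩ :=
      Subtype.ext hemp
    rw [this, hφ.map_empty] at hmem
    exact hmem
  · intro hu
    have hmem : u ∈ φ ⟨(a u).1 ∩ A.1, (𝔓.measurableSet_sigma_part (a u).2).inter A.2⟩ := by
      have : (⟨_, (𝔓.measurableSet_sigma_part (a u).2).inter A.2⟩ :
        {A : Set Y // MeasurableSet[𝔓.sigma] A}) = ⟨(a u).1, 𝔓.measurableSet_sigma_part (a u).2⟩ :=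
        Subtype.ext (inter_eq_left.2 hu)
      rw [this]
      exact ha u
    rw [hinter] at hmem
    exact hmem.2

theorem isHom_preimage {Y : Type*} (m : MeasurableSpace Y) {d : ℕ} (c : Fin d → Y) :
    IsHom m fun A => c ⁻¹' A.1 where
  map_union _ _ := rfl
  map_inter _ _ := rfl
  map_empty := rfl
  map_univ := rfl

theorem fullGroupoid_act_symmDiff_subset {d : ℕ} (s t : Set (Fin d × Fin d)) (A : Set (Fin d)) :
    (fullGroupoid d).act s A ∆ (fullGroupoid d).act t A ⊆ Prod.fst '' (s ∆ t) := by
  rintro u (⟨⟨x, ⟨hx, hA⟩, rfl⟩, hn⟩ | ⟨⟨x, ⟨hx, hA⟩, rfl⟩, hn⟩)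
  · exact ⟨x, Or.inl ⟨hx, fun h => hn ⟨x, ⟨h, hA⟩, rfl⟩⟩, rfl⟩
  · exact ⟨x, Or.inr ⟨hx, fun h => hn ⟨x, ⟨h, hA⟩, rfl⟩⟩, rfl⟩

theorem normCard_act_symmDiff_le {d : ℕ} (s t : Set (Fin d × Fin d)) (A : Set (Fin d)) :
    normCard d ((fullGroupoid d).act s A ∆ (fullGroupoid d).act t A) ≤ normCard d (s ∆ t) := by
  refine (normCard_mono d (fullGroupoid_act_symmDiff_subset s t A)).trans ?_
  unfold normCard
  gcongr
  exact ncard_image_le (toFinite _)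

/-! ### Transfer of good homomorphisms between two families -/

section Compare

variable {Y G X H : Type*} [MeasurableSpace Y] [MeasurableSpace G] [MeasurableSpace X]
  [StandardBorelSpace X] [MeasurableSpace H] [StandardBorelSpace H]
  {𝓖 : DiscreteBorelGroupoid Y G} {𝓗 : DiscreteBorelGroupoid X H}

theorem FinitePartition.dyn_coarser (𝔓 : FinitePartition Y) (π : ClassBijectiveExtension 𝓖 𝓗)
    {F F' : Finset 𝓗.PartialAut} (h : F ⊆ F') : (𝔓.dyn π F).Coarser (𝔓.dyn π F') := by
  classical
  exact FinitePartition.generated_coarser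
    (Finset.image_subset_image (Finset.product_subset_product_left h))

theorem FinitePartition.isBorel_dyn {𝔓 : FinitePartition Y} {π : ClassBijectiveExtension 𝓖 𝓗}
    {F : Finset 𝓗.PartialAut} (h : ∀ f ∈ F, ∀ P ∈ 𝔓.parts, MeasurableSet (π.act f P)) :
    (𝔓.dyn π F).IsBorel := by
  classical
  refine FinitePartition.isBorel_generated fun A hA => ?_
  obtain ⟨⟨f, P⟩, hq, rfl⟩ := Finset.mem_image.1 hA
  obtain ⟨hf, hP⟩ := Finset.mem_product.1 hq
  exact h f hf P hP

open Classical in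
/-- Every good homomorphism for `(F', δ')` agrees on `Σ(𝔓)` with a good homomorphism for `(F, δ)`,
if every member of `F` is well approximated by a member of `F'`. -/
theorem goodHomsCard_le_of_approx (π : ClassBijectiveExtension 𝓖 𝓗) (μ : Measure Y)
    [IsFiniteMeasure μ] {d : ℕ} (hd : 0 < d) (σ : SoficMap 𝓗 d) {𝔔 𝔓 : FinitePartition Y}
    (hQ : 𝔔.Coarser 𝔓) (F F' : Finset 𝓗.PartialAut) (hF : PartialAut.one 𝓗 ∈ F)
    (hF' : PartialAut.one 𝓗 ∈ F')
    (hmeas : ∀ f ∈ F ∪ F', ∀ P ∈ 𝔓.parts, MeasurableSet (π.act f P)) {δ δ' ε₁ ε₂ : ℝ}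
    (happrox : ∀ f ∈ F, ∃ f' ∈ F', normCard d ((σ f).1 ∆ (σ f').1) ≤ ε₁ ∧
      ∀ P ∈ 𝔓.parts, μ.real (π.act f' P ∆ π.act f P) ≤ ε₂)
    (hδ : (𝔓.parts.card : ℝ) * ε₁ + δ' + 𝔓.parts.card *
      (ε₂ + (δ' + 2 * ((𝔓.dyn π (F ∪ F')).parts.card : ℝ) / d)) ≤ δ)
    (hδ' : δ' + 2 * ((𝔓.dyn π (F ∪ F')).parts.card : ℝ) / d < δ) :
    goodHomsCard π μ σ hQ F' hF' δ' ≤ goodHomsCard π μ σ hQ F hF δ := by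
  unfold goodHomsCard
  refine encard_le_encard ?_
  rintro _ ⟨φ, ⟨hφ, hφ1, hφ2⟩, rfl⟩
  obtain ⟨a, ha⟩ := hφ.exists_label
  set ℜ := 𝔓.dyn π (F ∪ F') with hℜ
  have hFR : (𝔓.dyn π F).Coarser ℜ := 𝔓.dyn_coarser π Finset.subset_union_left
  have hF'R : (𝔓.dyn π F').Coarser ℜ := 𝔓.dyn_coarser π Finset.subset_union_right
  have hRB : ℜ.IsBorel := FinitePartition.isBorel_dyn hmeas
  choose q hq hRq using fun R : ℜ.parts => hF'R R.1 R.2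
  let q' : ℜ.parts → (𝔓.dyn π F').parts := fun R => ⟨q R, hq R⟩
  have hiff : ∀ (R : ℜ.parts) (A : (𝔓.dyn π F').parts), R.1 ⊆ A.1 ↔ q' R = A := by
    intro R A
    constructor
    · intro h
      obtain ⟨y, hy⟩ := ℜ.part_nonempty R.2
      exact Subtype.ext ((𝔓.dyn π F').eq_of_mem_of_mem (hq R) A.2 (hRq R hy) (h hy))
    · rintro rfl
      exact hRq R
  have hsurj : Function.Surjective q' := by
    intro A
    obtain ⟨y, hy⟩ := (𝔓.dyn π F').part_nonempty A.2
    obtain ⟨R, hR, hyR⟩ := ℜ.exists_part_mem y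
    exact ⟨⟨R, hR⟩, Subtype.ext
      ((𝔓.dyn π F').eq_of_mem_of_mem (hq _) A.2 (hRq ⟨R, hR⟩ hyR) hy)⟩
  -- `φ` does not determine how the parts of `𝔓^{F'}` are cut by the refinement `ℜ`; the lift cuts
  -- them in proportions close to `μ`.
  obtain ⟨b, hb, hbsum⟩ := exists_lift_sum_abs_sub_le q' hsurj (fun R => μ.real R.1)
    (fun R => measureReal_nonneg) hd a
  have hφa : ∀ A : (𝔓.dyn π F').parts,
      φ ⟨A.1, (𝔓.dyn π F').measurableSet_sigma_part A.2⟩ = {u | a u = A} := by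
    intro A
    ext u
    rw [ha, mem_ofPred_eq]
    constructor
    · intro h
      obtain ⟨y, hy⟩ := (𝔓.dyn π F').part_nonempty (a u).2
      exact Subtype.ext ((𝔓.dyn π F').eq_of_mem_of_mem (a u).2 A.2 hy (h hy))
    · rintro rfl
      exact subset_rfl
  have hη : ∑ R : ℜ.parts, |normCard d {u | b u = R} - μ.real R.1| ≤
      δ' + 2 * (ℜ.parts.card : ℝ) / d := by
    refine hbsum.trans (add_le_add ?_ (by simp))
    refine le_trans (Finset.sum_le_sum fun A _ => ?_) hφ2.le
    rw [hφa, FinitePartition.measureReal_eq_sum_parts μ hRB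
      (FinitePartition.sigma_le_of_coarser hF'R _
        ((𝔓.dyn π F').measurableSet_sigma_part A.2))]
    simp only [hiff]
    exact le_rfl
  -- A sample point in each chosen part turns the labelling into a map `c` from `Fin d` to `Y`.
  -- Taking preimages under `c` recovers `φ` and is a homomorphism on every algebra of sets.
  choose c hc using fun u => ℜ.part_nonempty (b u).2
  have hcR : ∀ A, MeasurableSet[ℜ.sigma] A → ∀ u, c u ∈ A ↔ (b u).1 ⊆ A := fun A hA u =>
    ⟨fun h y hy => (ℜ.mem_iff_mem_of_measurableSet_sigma (b u).2 hA (hc u) hy).1 h,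
      fun h => h (hc u)⟩
  have hcφ : ∀ A : {A : Set Y // MeasurableSet[(𝔓.dyn π F').sigma] A}, φ A = c ⁻¹' A.1 := by
    intro A
    ext u
    rw [ha, mem_preimage]
    have hmem : c u ∈ (a u).1 := by
      rw [← hb u]
      exact hRq _ (hc u)
    exact ⟨fun h => h hmem, fun h y hy =>
      ((𝔓.dyn π F').mem_iff_mem_of_measurableSet_sigma (a u).2 A.2 hmem hy).1 h⟩
  have hfreq : ∀ A, MeasurableSet[ℜ.sigma] A →
      normCard d (c ⁻¹' A) ≤ μ.real A + (δ' + 2 * (ℜ.parts.card : ℝ) / d) := by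
    intro A hA
    have h := (FinitePartition.abs_normCard_sub_measureReal_le μ hRB b hA).trans hη
    have hset : c ⁻¹' A = {u | (b u).1 ⊆ A} := by
      ext u
      exact hcR A hA u
    rw [hset]
    linarith [(abs_le.1 h).2]
  refine ⟨fun A => c ⁻¹' A.1, ⟨isHom_preimage _ c, ?_, ?_⟩, ?_⟩
  · intro f hf
    obtain ⟨f', hf', h1, h2⟩ := happrox f hf
    -- Three errors: replacing `σ f` by `σ f'`, the defect of `φ` at `f'`, and replacing `f' · P` by
    -- `f · P`. The last is a frequency of a set in `Σ(ℜ)`, bounded through its measure.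
    have hact : ∀ P : 𝔓.parts, normCard d ((fullGroupoid d).act (σ f).1 (c ⁻¹' P.1) ∆
        (c ⁻¹' π.act f P.1)) ≤ ε₁ +
        normCard d ((fullGroupoid d).act (σ f').1 (c ⁻¹' P.1) ∆ (c ⁻¹' π.act f' P.1)) +
        (ε₂ + (δ' + 2 * (ℜ.parts.card : ℝ) / d)) := by
      intro P
      have m1 : MeasurableSet[ℜ.sigma] (π.act f P.1) := FinitePartition.measurableSet_dyn_act
        (Finset.mem_union_left _ hf) P.2
      have m2 : MeasurableSet[ℜ.sigma] (π.act f' P.1) := FinitePartition.measurableSet_dyn_act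
        (Finset.mem_union_right _ hf') P.2
      have e1 := normCard_symmDiff_triangle d ((fullGroupoid d).act (σ f).1 (c ⁻¹' P.1))
        ((fullGroupoid d).act (σ f').1 (c ⁻¹' P.1)) (c ⁻¹' π.act f P.1)
      have e2 := normCard_symmDiff_triangle d ((fullGroupoid d).act (σ f').1 (c ⁻¹' P.1))
        (c ⁻¹' π.act f' P.1) (c ⁻¹' π.act f P.1)
      have e3 := (normCard_act_symmDiff_le (σ f).1 (σ f').1 (c ⁻¹' P.1)).trans h1
      have e4 := hfreq (π.act f' P.1 ∆ π.act f P.1) (MeasurableSet.symmDiff m2 m1)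
      rw [preimage_symmDiff] at e4
      linarith [h2 P.1 P.2]
    have hsum := hφ1 f' hf'
    simp only [hcφ] at hsum
    refine lt_of_le_of_lt (Finset.sum_le_sum fun P _ => hact P) ?_
    rw [Finset.sum_add_distrib, Finset.sum_add_distrib]
    simp only [Finset.sum_const, Finset.card_univ, Fintype.card_coe, nsmul_eq_mul]
    linarith
  · refine lt_of_le_of_lt ?_ hδ'
    refine le_trans ?_ hη
    refine le_of_eq_of_le ?_
      (FinitePartition.sum_abs_normCard_sub_measureReal_le μ hRB hFR b)
    refine Finset.sum_congr rfl fun A _ => ?_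
    have hset : c ⁻¹' A.1 = {u | (b u).1 ⊆ A.1} := by
      ext u
      exact hcR A.1 (FinitePartition.sigma_le_of_coarser hFR _
        ((𝔓.dyn π F).measurableSet_sigma_part A.2)) u
    rw [← hset]
  -- Both homomorphisms are preimages under `c`, hence equal on `Σ(𝔔)`.
  · funext A
    exact (hcφ ⟨A.1, FinitePartition.sigma_le_dyn hF' A.1
      (FinitePartition.sigma_le_of_coarser hQ A.1 A.2)⟩).symm

/-! ### Translates `f · P` and their measures in the extension -/

theorem ClassBijectiveExtension.measurable_obj (π : ClassBijectiveExtension 𝓖 𝓗) :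
    Measurable π.obj := by
  have : π.obj = fun y => 𝓗.src (π.toFun (𝓖.unit y)) := by
    funext y
    rw [π.map_unit, 𝓗.src_unit]
  rw [this]
  exact 𝓗.measurable_src.comp (π.measurable_toFun.comp 𝓖.measurable_unit)

variable [StandardBorelSpace Y] [StandardBorelSpace G]

/-- The range map is injective on the preimage of `f`, since it is injective on `f` and `π` is
injective on range fibres; injective Borel images of Borel sets are Borel. -/
theorem ClassBijectiveExtension.measurableSet_act (π : ClassBijectiveExtension 𝓖 𝓗)
    (f : 𝓗.PartialAut) {P : Set Y} (hP : MeasurableSet P) : MeasurableSet (π.act f P) := by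
  refine MeasurableSet.image_of_measurable_injOn
    ((π.measurable_toFun f.2.1).inter (𝓖.measurable_src hP)) 𝓖.measurable_rng ?_
  rintro g ⟨hg, -⟩ g' ⟨hg', -⟩ he
  have hfr : InjOn 𝓗.rng f.1 := injOn_iff_injective.2 f.2.2.2.injective
  refine (π.bijOn_rng (𝓖.rng g)).injOn rfl he.symm (hfr hg hg' ?_)
  rw [π.rng_map, π.rng_map, he]

/-- Over the image the fibre count is at least one, so this is Markov's inequality at level one. -/
theorem measure_image_le_fiberCount {X H : Type*} [MeasurableSpace X] [StandardBorelSpace X]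
    [MeasurableSpace H] [StandardBorelSpace H] (ν : Measure X) [IsFiniteMeasure ν]
    {q : H → X} (hq : Measurable q) {B : Set H} (hB : MeasurableSet B) :
    ν (q '' B) ≤ fiberCount ν q hq B := by
  rw [fiberCount_apply ν q hq hB]
  refine le_trans (measure_mono ?_)
    ((one_mul _).ge.trans (mul_meas_ge_le_lintegral₀ (aemeasurable_encard_fiber ν hq hB) 1))
  rintro _ ⟨h, hh, rfl⟩
  have : 1 ≤ (q ⁻¹' {q h} ∩ B).encard := one_le_encard_iff_nonempty.2 ⟨h, rfl, hh⟩
  exact_mod_cast ENat.toENNReal_mono this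

/-- Bijectivity on range fibres makes the fibre counts upstairs and downstairs agree pointwise; the
rest is a change of variables along `obj`. -/
theorem ClassBijectiveExtension.fiberCount_rng_preimage (π : ClassBijectiveExtension 𝓖 𝓗)
    (μ : Measure Y) [IsFiniteMeasure μ] (ν : Measure X) [IsFiniteMeasure ν]
    (hπ : Measure.map π.obj μ = ν) {D : Set H} (hD : MeasurableSet D) :
    𝓖.rngMeasure μ (π.toFun ⁻¹' D) = 𝓗.rngMeasure ν D := by
  subst hπ
  rw [rngMeasure, rngMeasure, fiberCount_apply _ _ _ (π.measurable_toFun hD),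
    fiberCount_apply _ _ _ hD, lintegral_map' (aemeasurable_encard_fiber _ 𝓗.measurable_rng hD)
      π.measurable_obj.aemeasurable]
  refine lintegral_congr fun y => ?_
  have hb := π.bijOn_rng y
  have himg : π.toFun '' (𝓖.rng ⁻¹' {y} ∩ π.toFun ⁻¹' D) = 𝓗.rng ⁻¹' {π.obj y} ∩ D := by
    rw [image_inter_preimage, hb.image_eq]
  rw [← himg, (hb.injOn.mono inter_subset_left).encard_image]

/-- A point in only one of the two translates is the range of an element of the preimage of `f ∆
f'`. -/
theorem ClassBijectiveExtension.measure_act_symmDiff_le (π : ClassBijectiveExtension 𝓖 𝓗)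
    (μ : Measure Y) [IsFiniteMeasure μ] (ν : Measure X) [IsFiniteMeasure ν]
    (hπ : Measure.map π.obj μ = ν) (f f' : 𝓗.PartialAut) (P : Set Y) :
    μ (π.act f P ∆ π.act f' P) ≤ 𝓗.rngMeasure ν (f.1 ∆ f'.1) := by
  have hD : MeasurableSet (f.1 ∆ f'.1) := f.2.1.symmDiff f'.2.1
  rw [← π.fiberCount_rng_preimage μ ν hπ hD]
  refine (measure_mono ?_).trans
    (measure_image_le_fiberCount μ 𝓖.measurable_rng (π.measurable_toFun hD))
  rintro u (⟨⟨x, ⟨hx, hA⟩, rfl⟩, hn⟩ | ⟨⟨x, ⟨hx, hA⟩, rfl⟩, hn⟩)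
  · exact ⟨x, Or.inl ⟨hx, fun h => hn ⟨x, ⟨h, hA⟩, rfl⟩⟩, rfl⟩
  · exact ⟨x, Or.inr ⟨hx, fun h => hn ⟨x, ⟨h, hA⟩, rfl⟩⟩, rfl⟩

end Compare

/-! ### Monotonicity of limits along a bias -/

section BiasLimit

variable {J : Type*} [Preorder J]

theorem Bias.lim_mono (β : Bias J) {Φ Ψ : J → EReal} (h : ∀ᶠ j in atTop, Φ j ≤ Ψ j) :
    β.lim Φ ≤ β.lim Ψ := by
  cases β with
  | minus => exact liminf_le_liminf h
  | plus => exact limsup_le_limsup h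
  | ultrafilter β hβ =>
    have hle : (β : Filter J) ≤ atTop := le_iInf fun j => le_principal_iff.2 (hβ j)
    -- By compactness of the extended reals the ultralimit exists, so `limUnder` is a genuine limit
    -- and not a default value.
    have ht : ∀ Φ : J → EReal, Tendsto Φ β (𝓝 (limUnder (β : Filter J) Φ)) := fun Φ =>
      tendsto_nhds_limUnder ⟨_, (β.map Φ).le_nhds_lim⟩
    exact le_of_tendsto_of_tendsto (ht Φ) (ht Ψ) (hle h)

end BiasLimit

/-! ### Estimates for fibre-counting measures -/

section FiberCount

variable {X H : Type*} [MeasurableSpace X] [StandardBorelSpace X] [MeasurableSpace H]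
  [StandardBorelSpace H]

theorem DiscreteBorelGroupoid.PartialAut.injOn_src {𝓗 : DiscreteBorelGroupoid X H} (f : 𝓗.PartialAut) : InjOn 𝓗.src f.1 :=
  injOn_iff_injective.2 f.2.2.1.injective

theorem DiscreteBorelGroupoid.PartialAut.injOn_rng {𝓗 : DiscreteBorelGroupoid X H} (f : 𝓗.PartialAut) : InjOn 𝓗.rng f.1 :=
  injOn_iff_injective.2 f.2.2.2.injective

theorem fiberCount_eq_zero (ν : Measure X) [IsFiniteMeasure ν] {q : H → X} (hq : Measurable q)
    {B : Set H} (hB : MeasurableSet B) (h : ν (q '' B) = 0) : fiberCount ν q hq B = 0 := by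
  rw [fiberCount_apply ν q hq hB,
    lintegral_eq_zero_iff' (aemeasurable_encard_fiber ν hq hB)]
  refine (ae_iff (p := fun x => ((q ⁻¹' {x} ∩ B).encard : ℝ≥0∞) = 0)).2 (measure_mono_null ?_ h)
  intro x hx
  by_contra hxB
  refine hx ?_
  have : q ⁻¹' {x} ∩ B = ∅ := eq_empty_of_forall_notMem fun b hb => hxB ⟨b, hb.2, hb.1⟩
  rw [this]
  simp

/-- By injectivity the fibre count is at most the indicator function of `T`. -/
theorem fiberCount_inter_preimage_le (ν : Measure X) [IsFiniteMeasure ν] {q : H → X}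
    (hq : Measurable q) {B : Set H} (hB : MeasurableSet B) (hinj : InjOn q B) {T : Set X}
    (hT : MeasurableSet T) : fiberCount ν q hq (B ∩ q ⁻¹' T) ≤ ν T := by
  rw [fiberCount_apply ν q hq (hB.inter (hq hT))]
  refine le_trans (lintegral_mono fun x => ?_) (lintegral_indicator_one_le T)
  by_cases hx : x ∈ T
  · rw [indicator_of_mem hx]
    have : (q ⁻¹' {x} ∩ (B ∩ q ⁻¹' T)).encard ≤ 1 := by
      refine encard_le_one_iff.2 fun a b ha hb => hinj ha.2.1 hb.2.1 ?_
      exact (show q a = x from ha.1).trans (show q b = x from hb.1).symm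
    simpa using ENat.toENNReal_mono this
  · rw [indicator_of_notMem hx]
    have : q ⁻¹' {x} ∩ (B ∩ q ⁻¹' T) = ∅ :=
      eq_empty_of_forall_notMem fun b hb => hx ((show q b = x from hb.1) ▸ hb.2.2)
    rw [this]
    simp

theorem fiberCount_le_measure_univ (ν : Measure X) [IsFiniteMeasure ν] {q : H → X}
    (hq : Measurable q) {B : Set H} (hB : MeasurableSet B) (hinj : InjOn q B) :
    fiberCount ν q hq B ≤ ν univ := by
  simpa using fiberCount_inter_preimage_le ν hq hB hinj MeasurableSet.univ

end FiberCount

/-! ### Sets with null boundary -/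

section NullBoundary

variable {X : Type*} [MeasurableSpace X] [TopologicalSpace X] {ν : Measure X} {A B : Set X}

theorem DiscreteBorelGroupoid.NullBoundary.union (hA : NullBoundary ν A) (hB : NullBoundary ν B) :
    NullBoundary ν (A ∪ B) := by
  refine ⟨hA.1.union hB.1, measure_mono_null ?_ (measure_union_null hA.2 hB.2)⟩
  exact (frontier_union_subset A B).trans
    (union_subset_union inter_subset_left inter_subset_right)

theorem DiscreteBorelGroupoid.NullBoundary.diff (hA : NullBoundary ν A) (hB : NullBoundary ν B) :
    NullBoundary ν (A \ B) := by
  refine ⟨hA.1.diff hB.1, measure_mono_null ?_ (measure_union_null hA.2 hB.2)⟩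
  rw [← frontier_compl B]
  exact (frontier_inter_subset A Bᶜ).trans
    (union_subset_union inter_subset_left inter_subset_right)

theorem DiscreteBorelGroupoid.NullBoundary.iUnion {n : ℕ} {A : Fin n → Set X} (hA : ∀ i, NullBoundary ν (A i)) :
    NullBoundary ν (⋃ i, A i) := by
  induction n with
  | zero => simp [NullBoundary]
  | succ n ih =>
    have : ⋃ i, A i = A 0 ∪ ⋃ i : Fin n, A i.succ := by
      ext x
      simp [Fin.exists_fin_succ]
    rw [this]
    exact (hA 0).union (ih fun i => hA i.succ)

/-- A pmp partial homeomorphism `r ∘ s⁻¹` preserves the sets with null boundary which are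
compactly contained in its domain. -/
theorem DiscreteBorelGroupoid.NullBoundary.transfer {H : Type*} [StandardBorelSpace X] [MeasurableSpace H]
    [StandardBorelSpace H] [T2Space X] [BorelSpace X] [TopologicalSpace H] [BorelSpace H]
    [T2Space H] [IsFiniteMeasure ν] {s r : H → X} (hs : Continuous s) (hr : Continuous r)
    (hsr : fiberCount ν s hs.measurable = fiberCount ν r hr.measurable) {U K g : Set H}
    (hU : IsOpen U) (hUs : IsOpenEmbedding (U.domRestrict s))
    (hUr : IsOpenEmbedding (U.domRestrict r)) (hK : IsCompact K) (hKU : K ⊆ U) (hgK : g ⊆ K)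
    (h : NullBoundary ν (s '' g)) : NullBoundary ν (r '' g) := by
  have hinjs : InjOn s U := injOn_iff_injective.2 hUs.injective
  have hinjr : InjOn r U := injOn_iff_injective.2 hUr.injective
  have hgU := hgK.trans hKU
  have hg : MeasurableSet g := by
    have : g = U ∩ s ⁻¹' (s '' g) := by
      ext x
      refine ⟨fun hx => ⟨hgU hx, x, hx, rfl⟩, ?_⟩
      rintro ⟨hx, y, hy, he⟩
      exact hinjs (hgU hy) hx he ▸ hy
    rw [this]
    exact hU.measurableSet.inter (hs.measurable h.1)
  refine ⟨hg.image_of_measurable_injOn hr.measurable (hinjr.mono hgU), ?_⟩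
  set N := K ∩ s ⁻¹' frontier (s '' g) with hN
  have hNm : MeasurableSet N :=
    hK.measurableSet.inter (hs.measurable isClosed_frontier.measurableSet)
  -- Compactness of `K` keeps the boundary of `r '' g` inside `r '' U`. There both open embeddings
  -- pull the boundaries of `s '' g` and `r '' g` back to the same set, the boundary of `g` relative
  -- to `U`.
  have hsub : frontier (r '' g) ⊆ r '' N := by
    intro x hx
    have hcl : closure (r '' g) ⊆ r '' K :=
      closure_minimal (image_mono hgK) (hK.image hr).isClosed
    obtain ⟨k, hk, rfl⟩ := hcl hx.1
    refine ⟨k, ⟨hk, ?_⟩, rfl⟩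
    have pre : ∀ q : H → X, InjOn q U → U.domRestrict q ⁻¹' (q '' g) = Subtype.val ⁻¹' g := by
      intro q hq
      ext y
      constructor
      · rintro ⟨z, hz, he⟩
        have hzy : z = y.1 := hq (hgU hz) y.2 he
        exact mem_preimage.2 (hzy ▸ hz)
      · exact fun hy => ⟨y, hy, rfl⟩
    have h1 := hUs.isOpenMap.preimage_frontier_eq_frontier_preimage hUs.continuous (s '' g)
    have h2 := hUr.isOpenMap.preimage_frontier_eq_frontier_preimage hUr.continuous (r '' g)
    rw [pre s hinjs] at h1
    rw [pre r hinjr, ← h1] at h2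
    have h3 : (⟨k, hKU hk⟩ : U) ∈ U.domRestrict r ⁻¹' frontier (r '' g) := hx
    rw [h2] at h3
    exact h3
  refine measure_mono_null hsub (le_antisymm ?_ zero_le)
  -- The pmp hypothesis turns the range count of `N` into its source count, which vanishes because
  -- the sources of `N` lie in a null set.
  refine (measure_image_le_fiberCount ν hr.measurable hNm).trans ?_
  rw [← hsr, fiberCount_eq_zero ν hs.measurable hNm]
  exact measure_mono_null (by rintro _ ⟨x, hx, rfl⟩; exact hx.2) h.2

end NullBoundary

/-! ### Density of `⟦𝓗⟧_top` -/

section Approximation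

variable {X H : Type*} [MeasurableSpace X] [StandardBorelSpace X] [MeasurableSpace H]
  [StandardBorelSpace H] [TopologicalSpace X] [BorelSpace X] [TopologicalSpace H] [BorelSpace H]
  [T2Space H] {𝓗 : DiscreteBorelGroupoid X H} {ν : Measure X} {g : Set H}

/-- A set compactly contained in a bisection, whose source and range have null boundary. -/
def IsContinuityBisection (𝓗 : DiscreteBorelGroupoid X H) (ν : Measure X) (g : Set H) : Prop :=
  (∃ U K, 𝓗.IsBisection U ∧ IsCompact K ∧ K ⊆ U ∧ g ⊆ K) ∧
    NullBoundary ν (𝓗.src '' g) ∧ NullBoundary ν (𝓗.rng '' g)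

theorem IsContinuityBisection.injOn_src (hg : IsContinuityBisection 𝓗 ν g) : InjOn 𝓗.src g := by
  obtain ⟨⟨U, K, hU, -, hKU, hgK⟩, -⟩ := hg
  exact (injOn_iff_injective.2 hU.2.1.injective).mono (hgK.trans hKU)

theorem IsContinuityBisection.injOn_rng (hg : IsContinuityBisection 𝓗 ν g) : InjOn 𝓗.rng g := by
  obtain ⟨⟨U, K, hU, -, hKU, hgK⟩, -⟩ := hg
  exact (injOn_iff_injective.2 hU.2.2.injective).mono (hgK.trans hKU)

theorem IsContinuityBisection.measurableSet (hg : IsContinuityBisection 𝓗 ν g) :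
    MeasurableSet g := by
  obtain ⟨⟨U, K, hU, -, hKU, hgK⟩, hs, -⟩ := hg
  have hinjs : InjOn 𝓗.src U := injOn_iff_injective.2 hU.2.1.injective
  have : g = U ∩ 𝓗.src ⁻¹' (𝓗.src '' g) := by
    ext x
    refine ⟨fun hx => ⟨hKU (hgK hx), x, hx, rfl⟩, ?_⟩
    rintro ⟨hx, y, hy, he⟩
    exact hinjs (hKU (hgK hy)) hx he ▸ hy
  rw [this]
  exact hU.1.measurableSet.inter (𝓗.measurable_src hs.1)

variable [T2Space X] [IsProbabilityMeasure ν]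

theorem IsContinuityBisection.of_src (htop : 𝓗.IsTopological) (hpmp : 𝓗.IsPMP ν) {U K : Set H}
    (hU : 𝓗.IsBisection U) (hK : IsCompact K) (hKU : K ⊆ U) (hgK : g ⊆ K)
    (h : NullBoundary ν (𝓗.src '' g)) : IsContinuityBisection 𝓗 ν g :=
  ⟨⟨U, K, hU, hK, hKU, hgK⟩, h,
    h.transfer htop.continuous_src htop.continuous_rng hpmp hU.1 hU.2.1 hU.2.2 hK hKU hgK⟩

theorem IsContinuityBisection.of_rng (htop : 𝓗.IsTopological) (hpmp : 𝓗.IsPMP ν) {U K : Set H}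
    (hU : 𝓗.IsBisection U) (hK : IsCompact K) (hKU : K ⊆ U) (hgK : g ⊆ K)
    (h : NullBoundary ν (𝓗.rng '' g)) : IsContinuityBisection 𝓗 ν g :=
  ⟨⟨U, K, hU, hK, hKU, hgK⟩,
    h.transfer htop.continuous_rng htop.continuous_src hpmp.symm hU.1 hU.2.2 hU.2.1 hK hKU hgK, h⟩

/-- After each removal one side visibly keeps a null boundary, and `NullBoundary.transfer` supplies
the other side. -/
theorem IsContinuityBisection.diff (htop : 𝓗.IsTopological) (hpmp : 𝓗.IsPMP ν)
    (hg : IsContinuityBisection 𝓗 ν g) {S R : Set X} (hS : NullBoundary ν S)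
    (hR : NullBoundary ν R) :
    IsContinuityBisection 𝓗 ν ((g \ 𝓗.src ⁻¹' S) \ 𝓗.rng ⁻¹' R) := by
  obtain ⟨⟨U, K, hU, hK, hKU, hgK⟩, hs, -⟩ := hg
  have h1 : IsContinuityBisection 𝓗 ν (g \ 𝓗.src ⁻¹' S) := by
    refine .of_src htop hpmp hU hK hKU (sdiff_subset.trans hgK) ?_
    rw [image_sdiff_preimage]
    exact hs.diff hS
  refine .of_rng htop hpmp hU hK hKU ((sdiff_subset.trans sdiff_subset).trans hgK) ?_
  rw [image_sdiff_preimage]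
  exact h1.2.2.diff hR

/-- Finitely many continuity bisections contain disjoint ones, with disjoint sources and ranges,
which are maximal. -/
theorem exists_disjoint_continuityBisections (htop : 𝓗.IsTopological) (hpmp : 𝓗.IsPMP ν) {n : ℕ}
    (g : Fin n → Set H) (hg : ∀ i, IsContinuityBisection 𝓗 ν (g i)) :
    ∃ f : Fin n → Set H, (∀ i, IsContinuityBisection 𝓗 ν (f i)) ∧ (∀ i, f i ⊆ g i) ∧
      Pairwise (fun i j => Disjoint (𝓗.src '' f i) (𝓗.src '' f j)) ∧
      Pairwise (fun i j => Disjoint (𝓗.rng '' f i) (𝓗.rng '' f j)) ∧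
      ∀ i, ∀ h ∈ g i, ∃ j, ∃ h' ∈ f j, 𝓗.src h' = 𝓗.src h ∨ 𝓗.rng h' = 𝓗.rng h := by
  induction n with
  | zero => exact ⟨g, hg, fun i => i.elim0, fun i => i.elim0, fun i => i.elim0, fun i => i.elim0⟩
  | succ n ih =>
    obtain ⟨f, hf, hfg, hs, hr, hmax⟩ := ih (fun i => g i.succ) fun i => hg i.succ
    -- The new set loses exactly the elements whose source or range is already taken, which is why
    -- maximality persists.
    set f₀ := (g 0 \ 𝓗.src ⁻¹' ⋃ i, 𝓗.src '' f i) \ 𝓗.rng ⁻¹' ⋃ i, 𝓗.rng '' f i with hf₀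
    have hds : ∀ i, Disjoint (𝓗.src '' f₀) (𝓗.src '' f i) := by
      intro i
      rw [disjoint_left]
      rintro _ ⟨x, hx, rfl⟩ hxi
      exact hx.1.2 (mem_iUnion.2 ⟨i, hxi⟩)
    have hdr : ∀ i, Disjoint (𝓗.rng '' f₀) (𝓗.rng '' f i) := by
      intro i
      rw [disjoint_left]
      rintro _ ⟨x, hx, rfl⟩ hxi
      exact hx.2 (mem_iUnion.2 ⟨i, hxi⟩)
    refine ⟨Fin.cons f₀ f, ?_, ?_, ?_, ?_, ?_⟩
    · refine Fin.cases ?_ hf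
      exact (hg 0).diff htop hpmp (.iUnion fun i => (hf i).2.1) (.iUnion fun i => (hf i).2.2)
    · refine Fin.cases ?_ hfg
      exact sdiff_subset.trans sdiff_subset
    · refine Fin.cases (Fin.cases (fun h => (h rfl).elim) fun j _ => hds j) fun i =>
        Fin.cases (fun _ => (hds i).symm) fun j hij => @hs i j fun h => hij (congrArg Fin.succ h)
    · refine Fin.cases (Fin.cases (fun h => (h rfl).elim) fun j _ => hdr j) fun i =>
        Fin.cases (fun _ => (hdr i).symm) fun j hij => @hr i j fun h => hij (congrArg Fin.succ h)
    · refine Fin.cases (fun h hh => ?_) fun i h hh => ?_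
      · by_cases h1 : h ∈ 𝓗.src ⁻¹' ⋃ i, 𝓗.src '' f i
        · obtain ⟨i, h', hh', he⟩ := mem_iUnion.1 h1
          exact ⟨i.succ, h', hh', Or.inl he⟩
        by_cases h2 : h ∈ 𝓗.rng ⁻¹' ⋃ i, 𝓗.rng '' f i
        · obtain ⟨i, h', hh', he⟩ := mem_iUnion.1 h2
          exact ⟨i.succ, h', hh', Or.inr he⟩
        exact ⟨0, h, ⟨⟨hh, h1⟩, h2⟩, Or.inl rfl⟩
      · obtain ⟨j, h', hh', he⟩ := hmax i h hh
        exact ⟨j.succ, h', hh', he⟩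

theorem DiscreteBorelGroupoid.PartialAut.isTop_of_iUnion (htop : 𝓗.IsTopological) (f : 𝓗.PartialAut) {n : ℕ}
    {g : Fin n → Set H} (hfg : f.1 = ⋃ i, g i) (hg : ∀ i, IsContinuityBisection 𝓗 ν (g i))
    (hs : Pairwise fun i j => Disjoint (𝓗.src '' g i) (𝓗.src '' g j))
    (hr : Pairwise fun i j => Disjoint (𝓗.rng '' g i) (𝓗.rng '' g j)) : f.IsTop ν := by
  refine ⟨n, g, hfg, fun i => ?_, fun i => (hg i).2.1, hs, fun i => (hg i).2.2, hr⟩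
  obtain ⟨⟨U, K, hU, hK, hKU, hgK⟩, -⟩ := hg i
  exact ⟨U, hU, (closure_minimal hgK hK.isClosed).trans hKU,
    (closure_minimal (image_mono hgK) (hK.image htop.continuous_src).isClosed).trans
      (image_mono hKU),
    (closure_minimal (image_mono hgK) (hK.image htop.continuous_rng).isClosed).trans
      (image_mono hKU)⟩

/-- The sets are local lifts through the source map of balls about the source of `h`; arbitrarily
small radii give balls with null boundary, and the closed balls lift to compact sets. -/
theorem exists_continuityBisection_nhds [CompactSpace X] [TopologicalSpace.MetrizableSpace X]
    (htop : 𝓗.IsTopological) (hetale : 𝓗.IsEtale) (hpmp : 𝓗.IsPMP ν) {V : Set H} (hV : IsOpen V)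
    {h : H} (hh : h ∈ V) : ∃ g, IsOpen g ∧ h ∈ g ∧ g ⊆ V ∧ IsContinuityBisection 𝓗 ν g := by
  let _ := TopologicalSpace.metrizableSpaceMetric X
  obtain ⟨U, hU, hhU⟩ := hetale h
  have hinj : InjOn 𝓗.src U := injOn_iff_injective.2 hU.2.1.injective
  have hrange : range (U.domRestrict 𝓗.src) = 𝓗.src '' U := range_domRestrict _ _
  have hopen : IsOpen (𝓗.src '' (U ∩ V)) := by
    have := hU.2.1.isOpenMap _ (hV.preimage (continuous_subtype_val (p := (· ∈ U))))
    rwa [domRestrict_eq, image_comp, Subtype.image_preimage_coe] at this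
  obtain ⟨ρ, hρ, hball⟩ := Metric.isOpen_iff.1 hopen (𝓗.src h) ⟨h, ⟨hhU, hh⟩, rfl⟩
  obtain ⟨ρ', ⟨hρ0, hρ'⟩, hnull⟩ := exists_null_frontier_thickening ν {𝓗.src h} hρ
  rw [Metric.thickening_singleton] at hnull
  have hcb : Metric.closedBall (𝓗.src h) ρ' ⊆ 𝓗.src '' (U ∩ V) :=
    (Metric.closedBall_subset_ball hρ').trans hball
  have hcbU := hcb.trans (image_mono inter_subset_left)
  have hbU := Metric.ball_subset_closedBall.trans hcbU
  have hK : IsCompact (U ∩ 𝓗.src ⁻¹' Metric.closedBall (𝓗.src h) ρ') := by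
    have h1 := (hU.2.1.isInducing.isCompact_preimage_iff (hrange ▸ hcbU)).2
      (isCompact_closedBall (𝓗.src h) ρ')
    have h2 := h1.image continuous_subtype_val
    rwa [domRestrict_eq, preimage_comp, Subtype.image_preimage_coe] at h2
  refine ⟨U ∩ 𝓗.src ⁻¹' Metric.ball (𝓗.src h) ρ',
    hU.1.inter (Metric.isOpen_ball.preimage htop.continuous_src),
    ⟨hhU, Metric.mem_ball_self hρ0⟩, ?_, ?_⟩
  · rintro x ⟨hxU, hx⟩
    obtain ⟨y, ⟨hyU, hyV⟩, he⟩ := hcb (Metric.ball_subset_closedBall hx)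
    exact hinj hyU hxU he ▸ hyV
  · refine .of_src htop hpmp hU hK inter_subset_left
      (inter_subset_inter_right _ (preimage_mono Metric.ball_subset_closedBall)) ?_
    rw [image_inter_preimage, inter_eq_right.2 hbU]
    exact ⟨Metric.isOpen_ball.measurableSet, hnull⟩

/-- `⟦𝓗⟧_top` is dense in `⟦𝓗⟧`. -/
theorem exists_isTop_symmDiff_le [CompactSpace X] [TopologicalSpace.MetrizableSpace X]
    (htop : 𝓗.IsTopological) (hetale : 𝓗.IsEtale) (hpmp : 𝓗.IsPMP ν)
    (hreg : (𝓗.srcMeasure ν).Regular) (f : 𝓗.PartialAut) {ε : ℝ≥0∞} (hε : ε ≠ 0) :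
    ∃ f' : 𝓗.PartialAut, f'.IsTop ν ∧ 𝓗.srcMeasure ν (f.1 ∆ f'.1) ≤ 4 * ε := by
  set M := 𝓗.srcMeasure ν with hM
  have hMr : M = 𝓗.rngMeasure ν := hpmp
  have hfin : M f.1 ≠ ∞ :=
    ((fiberCount_le_measure_univ ν 𝓗.measurable_src f.2.1 f.injOn_src).trans_lt
      (measure_lt_top ν univ)).ne
  obtain ⟨K, hKf, hK, hKε⟩ := f.2.1.exists_isCompact_sdiff_lt hfin hε
  have hKfin : M K ≠ ∞ := ((measure_mono hKf).trans_lt hfin.lt_top).ne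
  obtain ⟨V, hKV, hV, -, hVε⟩ := hK.measurableSet.exists_isOpen_sdiff_lt hKfin hε
  choose N hNo hhN hNV hN using fun (h : H) (hh : h ∈ K) =>
    exists_continuityBisection_nhds htop hetale hpmp hV (hKV hh)
  obtain ⟨t, ht⟩ := hK.elim_nhds_subcover' N fun h hh => (hNo h hh).mem_nhds (hhN h hh)
  obtain ⟨g, hg, hgN, hs, hr, hmax⟩ := exists_disjoint_continuityBisections htop hpmp
    (fun i : Fin t.card => N (t.equivFin.symm i).1 (t.equivFin.symm i).1.2) fun i => hN _ _
  have hgV : ⋃ i, g i ⊆ V := iUnion_subset fun i => (hgN i).trans (hNV _ _)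
  have hgm : MeasurableSet (⋃ i, g i) := .iUnion fun i => (hg i).measurableSet
  have hinj : ∀ q : H → X, (∀ i, InjOn q (g i)) →
      (Pairwise fun i j => Disjoint (q '' g i) (q '' g j)) → InjOn q (⋃ i, g i) := by
    intro q hq hd x hx y hy he
    obtain ⟨i, hx⟩ := mem_iUnion.1 hx
    obtain ⟨j, hy⟩ := mem_iUnion.1 hy
    rcases eq_or_ne i j with rfl | hij
    · exact hq i hx hy he
    · exact (disjoint_left.1 (hd hij) ⟨x, hx, rfl⟩ ⟨y, hy, he.symm⟩).elim
  have hinjs := hinj 𝓗.src (fun i => (hg i).injOn_src) hs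
  have hinjr := hinj 𝓗.rng (fun i => (hg i).injOn_rng) hr
  let f' : 𝓗.PartialAut := ⟨⋃ i, g i, isPartialAut_of_injOn 𝓗 hgm hinjs hinjr⟩
  refine ⟨f', PartialAut.isTop_of_iUnion htop f' rfl hg hs hr, ?_⟩
  -- The factor `4` counts `f \ K`, the excess `D`, and the parts `A`, `B` of `K` that share a
  -- source or a range with `D`. The last two are no larger than `D`, by injectivity of source and
  -- range on `K` and by the pmp hypothesis.
  set D := f'.1 \ K with hD
  have hDm : MeasurableSet D := hgm.diff hK.measurableSet
  have hDε : M D ≤ ε := (measure_mono (sdiff_subset_sdiff_left hgV)).trans hVε.le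
  set A := K ∩ 𝓗.src ⁻¹' (𝓗.src '' D) with hA
  set B := K ∩ 𝓗.rng ⁻¹' (𝓗.rng '' D) with hB
  have hAε : M A ≤ ε := (fiberCount_inter_preimage_le ν 𝓗.measurable_src hK.measurableSet
    (f.injOn_src.mono hKf) (hDm.image_of_measurable_injOn 𝓗.measurable_src
      (hinjs.mono sdiff_subset))).trans
    ((measure_image_le_fiberCount ν 𝓗.measurable_src hDm).trans hDε)
  have hBε : M B ≤ ε := by
    rw [hMr] at hDε ⊢
    exact (fiberCount_inter_preimage_le ν 𝓗.measurable_rng hK.measurableSet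
      (f.injOn_rng.mono hKf) (hDm.image_of_measurable_injOn 𝓗.measurable_rng
        (hinjr.mono sdiff_subset))).trans
      ((measure_image_le_fiberCount ν 𝓗.measurable_rng hDm).trans hDε)
  have hsub : f.1 ∆ f'.1 ⊆ (f.1 \ K) ∪ D ∪ A ∪ B := by
    rintro x (⟨hx, hx'⟩ | ⟨hx, hx'⟩)
    · by_cases hxK : x ∈ K
      · obtain ⟨y, hy, hxy⟩ := mem_iUnion₂.1 (ht hxK)
        obtain ⟨j, x', hx'j, he⟩ := hmax (t.equivFin ⟨y, hy⟩) x
          (by rw [Equiv.symm_apply_apply]; exact hxy)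
        have hx'f : x' ∈ f'.1 := mem_iUnion.2 ⟨j, hx'j⟩
        -- Inside `K ⊆ f` a common source or range would force `x' = x`, but `x` is not in `f'`.
        have hx'K : x' ∉ K := by
          intro hx'K
          refine hx' ?_
          rcases he with he | he
          · exact f.injOn_src (hKf hx'K) hx he ▸ hx'f
          · exact f.injOn_rng (hKf hx'K) hx he ▸ hx'f
        rcases he with he | he
        · exact Or.inl (Or.inr ⟨hxK, x', ⟨hx'f, hx'K⟩, he⟩)
        · exact Or.inr ⟨hxK, x', ⟨hx'f, hx'K⟩, he⟩
      · exact Or.inl (Or.inl (Or.inl ⟨hx, hxK⟩))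
    · exact Or.inl (Or.inl (Or.inr ⟨hx, fun hxK => hx' (hKf hxK)⟩))
  calc M (f.1 ∆ f'.1) ≤ M (f.1 \ K ∪ D ∪ A) + M B :=
        (measure_mono hsub).trans (measure_union_le _ _)
    _ ≤ M (f.1 \ K ∪ D) + M A + M B := by gcongr; exact measure_union_le _ _
    _ ≤ M (f.1 \ K) + M D + M A + M B := by gcongr; exact measure_union_le _ _
    _ ≤ ε + ε + ε + ε := by gcongr
    _ = 4 * ε := by ring

/-- The unit space of an étale groupoid is open. -/
theorem isOpen_units (htop : 𝓗.IsTopological) (hetale : 𝓗.IsEtale) : IsOpen 𝓗.units := by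
  rw [isOpen_iff_mem_nhds]
  rintro _ ⟨x, rfl⟩
  obtain ⟨U, hU, hxU⟩ := hetale (𝓗.unit x)
  have hinj : InjOn 𝓗.src U := injOn_iff_injective.2 hU.2.1.injective
  have hcont : Continuous fun h => 𝓗.unit (𝓗.src h) :=
    htop.continuous_unit.comp htop.continuous_src
  have hmem : (fun h => 𝓗.unit (𝓗.src h)) ⁻¹' U ∈ 𝓝 (𝓗.unit x) := by
    refine hcont.continuousAt.preimage_mem_nhds (hU.1.mem_nhds ?_)
    rwa [𝓗.src_unit]
  filter_upwards [hU.1.mem_nhds hxU, hmem] with h hh hh'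
  -- `h` and the unit at its source lie in the same bisection and have the same source, so they
  -- coincide.
  exact ⟨𝓗.src h, hinj hh' hh (𝓗.src_unit _)⟩

/-- The unit space is open and compact, so it is itself a closed bisection; its source and range are
all of `X`, with empty boundary. -/
theorem DiscreteBorelGroupoid.PartialAut.isTop_one [CompactSpace X] (htop : 𝓗.IsTopological) (hetale : 𝓗.IsEtale) :
    (PartialAut.one 𝓗).IsTop ν := by
  have hsrc : 𝓗.src '' 𝓗.units = univ :=
    eq_univ_of_forall fun x => ⟨_, ⟨x, rfl⟩, 𝓗.src_unit x⟩
  have hrng : 𝓗.rng '' 𝓗.units = univ :=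
    eq_univ_of_forall fun x => ⟨_, ⟨x, rfl⟩, 𝓗.rng_unit x⟩
  have hopen := isOpen_units htop hetale
  have hemb : ∀ q : H → X, Continuous q → (∀ x, q (𝓗.unit x) = x) →
      IsOpenEmbedding (𝓗.units.domRestrict q) := by
    intro q hq hqu
    let e : 𝓗.units ≃ₜ X :=
      { toFun := 𝓗.units.domRestrict q
        invFun := fun x => ⟨𝓗.unit x, x, rfl⟩
        left_inv := by
          rintro ⟨_, x, rfl⟩
          exact Subtype.ext (congrArg 𝓗.unit (hqu x))
        right_inv := hqu
        continuous_toFun := hq.comp continuous_subtype_val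
        continuous_invFun := htop.continuous_unit.subtype_mk _ }
    exact e.isOpenEmbedding
  have hclosed : IsClosed 𝓗.units := (isCompact_range htop.continuous_unit).isClosed
  refine ⟨1, fun _ => 𝓗.units, (iUnion_const _).symm, fun _ => ⟨𝓗.units,
    ⟨hopen, hemb _ htop.continuous_src 𝓗.src_unit, hemb _ htop.continuous_rng 𝓗.rng_unit⟩,
    hclosed.closure_subset, ?_, ?_⟩, fun _ => ?_, Subsingleton.pairwise, fun _ => ?_,
    Subsingleton.pairwise⟩
  · rw [hsrc]; exact subset_univ _
  · rw [hrng]; exact subset_univ _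
  · rw [hsrc]; simp [NullBoundary]
  · rw [hrng]; simp [NullBoundary]

end Approximation

/-! ### Domination of `(F, δ)` by a pair from `⟦𝓗⟧_top` -/

section Main

variable {X H J : Type*} [MeasurableSpace X] [StandardBorelSpace X] [MeasurableSpace H]
  [StandardBorelSpace H] [TopologicalSpace X] [BorelSpace X] [CompactSpace X]
  [TopologicalSpace.MetrizableSpace X] [TopologicalSpace H] [BorelSpace H] [T2Space H]
  {𝓗 : DiscreteBorelGroupoid X H} {ν : Measure X} [IsProbabilityMeasure ν]

/-- `⟦𝓗⟧_top` is dense in `⟦𝓗⟧`, with a real bound for the distance. -/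
theorem exists_isTop_measureReal_symmDiff_le (htop : 𝓗.IsTopological) (hetale : 𝓗.IsEtale)
    (hpmp : 𝓗.IsPMP ν) (hreg : (𝓗.srcMeasure ν).Regular) (f : 𝓗.PartialAut) {ε : ℝ}
    (hε : 0 < ε) : ∃ f' : 𝓗.PartialAut, f'.IsTop ν ∧
      𝓗.srcMeasure ν (f.1 ∆ f'.1) ≤ ENNReal.ofReal ε := by
  obtain ⟨f', hf', h⟩ := exists_isTop_symmDiff_le htop hetale hpmp hreg f
    (ENNReal.ofReal_pos.2 (by positivity : 0 < ε / 4)).ne'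
  refine ⟨f', hf', h.trans_eq ?_⟩
  rw [show (4 : ℝ≥0∞) = ENNReal.ofReal 4 by simp, ← ENNReal.ofReal_mul (by norm_num)]
  congr 1
  ring

variable [Preorder J] [IsDirectedOrder J] [Nonempty J] {d : J → ℕ}
  {ℙ : ∀ j, Measure (SoficMap 𝓗 (d j))}
  {Y G : Type*} [MeasurableSpace Y] [StandardBorelSpace Y] [MeasurableSpace G]
  [StandardBorelSpace G] {𝓖 : DiscreteBorelGroupoid Y G} {μ : Measure Y} [IsProbabilityMeasure μ]

theorem exists_isTop_entropyAt_le (htop : 𝓗.IsTopological) (hetale : 𝓗.IsEtale)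
    (hpmp : 𝓗.IsPMP ν) (hreg : (𝓗.srcMeasure ν).Regular) (hd : Tendsto d atTop atTop)
    (hcont : IsAsymptoticallyContinuous 𝓗 ν d ℙ) (p : ℝ≥0∞) (β : Bias J)
    (π : ClassBijectiveExtension 𝓖 𝓗) (hπ : Measure.map π.obj μ = ν) {𝔔 𝔓 : FinitePartition Y}
    (hPB : 𝔓.IsBorel) (hQ : 𝔔.Coarser 𝔓) (F : Finset 𝓗.PartialAut)
    (hF : PartialAut.one 𝓗 ∈ F) {δ : ℝ} (hδ : 0 < δ) :
    ∃ F' : Finset 𝓗.PartialAut, (∀ f ∈ F', f.IsTop ν) ∧ ∃ hF' : PartialAut.one 𝓗 ∈ F',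
      ∃ δ' > 0, entropyAt d ℙ p β π μ hQ F' hF' δ' ≤ entropyAt d ℙ p β π μ hQ F hF δ := by
  classical
  set k := (𝔓.parts.card : ℝ) with hk
  have hk0 : 0 ≤ k := Nat.cast_nonneg _
  -- With `ε₁ = 2ε`, `ε₂ = δ' = ε` and rounding error at most `ε`, the action defect is bounded by
  -- `2kε + ε + 3kε = (5k + 1)ε` and the frequency defect by `2ε`. The constant `3` keeps the second
  -- bound strictly below `δ` even when `k = 0`.
  set ε : ℝ := δ / (5 * k + 3) with hε
  have hε0 : 0 < ε := by positivity
  have hεδ : (5 * k + 3) * ε = δ := by rw [hε]; field_simp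
  choose t ht htε using fun f : 𝓗.PartialAut =>
    exists_isTop_measureReal_symmDiff_le htop hetale hpmp hreg f hε0
  have hν : ∀ f : 𝓗.PartialAut, (𝓗.srcMeasure ν).real (f.1 ∆ (t f).1) ≤ ε := fun f =>
    ENNReal.toReal_le_of_le_ofReal hε0.le (htε f)
  refine ⟨insert (PartialAut.one 𝓗) (F.image t), ?_, Finset.mem_insert_self _ _, ε, hε0, ?_⟩
  · intro f hf
    rcases Finset.mem_insert.1 hf with rfl | hf
    · exact PartialAut.isTop_one htop hetale
    · obtain ⟨f, -, rfl⟩ := Finset.mem_image.1 hf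
      exact ht f
  set F' := insert (PartialAut.one 𝓗) (F.image t) with hF'
  set m := ((𝔓.dyn π (F ∪ F')).parts.card : ℝ) with hm
  obtain ⟨j₀, hj₀⟩ := hcont (F ∪ F') ε hε0
  -- This makes the rounding error `2m / d` at most `ε`; the summand `1` ensures `d j > 0` also when
  -- `m = 0`.
  have hlarge : ∀ᶠ j in atTop, 2 * m / ε + 1 ≤ (d j : ℝ) :=
    (tendsto_natCast_atTop_atTop.comp hd).eventually_ge_atTop _
  refine β.lim_mono ?_
  filter_upwards [hlarge, eventually_ge_atTop j₀] with j hj hjj₀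
  have hm0 : 0 ≤ m := Nat.cast_nonneg _
  have hdpos : (0 : ℝ) < d j := lt_of_lt_of_le (by positivity) hj
  have hmd : 2 * m / d j ≤ ε := by
    rw [div_le_iff₀ hdpos]
    have := mul_le_mul_of_nonneg_left hj hε0.le
    rw [mul_add, mul_div_cancel₀ _ hε0.ne'] at this
    linarith
  refine mul_le_mul_of_nonneg_left (ENNReal.log_monotone (eLpNorm_mono_enorm_ae ?_))
    (EReal.coe_nonneg.2 (by positivity))
  filter_upwards [hj₀ j hjj₀] with σ hσ
  simp only [enorm_eq_self]
  refine ENat.toENNReal_mono (goodHomsCard_le_of_approx π μ (Nat.cast_pos.1 hdpos) σ hQ F F' hF _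
    (fun f _ P hP => π.measurableSet_act f (hPB P hP)) (ε₁ := 2 * ε) (ε₂ := ε)
    (fun f hf => ⟨t f, Finset.mem_insert_of_mem (Finset.mem_image_of_mem t hf), ?_,
      fun P _ => ?_⟩) ?_ ?_)
  -- Asymptotic continuity contributes one `ε` and the distance from `f` to `t f` the other.
  · have := hσ f (Finset.mem_union_left _ hf) (t f) (Finset.mem_union_right _
      (Finset.mem_insert_of_mem (Finset.mem_image_of_mem t hf)))
    linarith [hν f]
  · refine ENNReal.toReal_le_of_le_ofReal hε0.le ?_
    rw [symmDiff_comm]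
    refine (π.measure_act_symmDiff_le μ ν hπ f (t f) P).trans ?_
    rw [← (hpmp : 𝓗.srcMeasure ν = 𝓗.rngMeasure ν)]
    exact htε f
  · have := mul_le_mul_of_nonneg_left hmd hk0
    rw [← hk, ← hm]
    nlinarith
  · rw [← hm]
    nlinarith [mul_nonneg hk0 hε0.le]

end Main

end SoficEntropy

theorem theorem8p3 {X H J : Type*}
    [MeasurableSpace X] [StandardBorelSpace X] [MeasurableSpace H] [StandardBorelSpace H]
    [TopologicalSpace X] [BorelSpace X] [CompactSpace X] [TopologicalSpace.MetrizableSpace X]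
    [TopologicalSpace H] [BorelSpace H] [T2Space H]
    (𝓗 : SoficEntropy.DiscreteBorelGroupoid X H) (htop : 𝓗.IsTopological) (hetale : 𝓗.IsEtale)
    (ν : MeasureTheory.Measure X) [MeasureTheory.IsProbabilityMeasure ν] (hpmp : 𝓗.IsPMP ν)
    (hreg : (𝓗.srcMeasure ν).Regular)
    [Preorder J] [IsDirectedOrder J] [Nonempty J] (d : J → ℕ)
    (ℙ : ∀ j, MeasureTheory.Measure (SoficEntropy.SoficMap 𝓗 (d j)))
    (hsofic : SoficEntropy.IsSoficApproximation 𝓗 ν d ℙ)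
    (hcont : SoficEntropy.IsAsymptoticallyContinuous 𝓗 ν d ℙ)
    (p : ENNReal) (hp : 1 ≤ p) (β : SoficEntropy.Bias J)
    {Y G : Type*} [MeasurableSpace Y] [StandardBorelSpace Y] [MeasurableSpace G]
    [StandardBorelSpace G] (𝓖 : SoficEntropy.DiscreteBorelGroupoid Y G)
    (μ : MeasureTheory.Measure Y) [MeasureTheory.IsProbabilityMeasure μ] (hμ : 𝓖.IsPMP μ)
    (π : SoficEntropy.ClassBijectiveExtension 𝓖 𝓗) (hπ : MeasureTheory.Measure.map π.obj μ = ν)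
    (𝔔 𝔓 : SoficEntropy.FinitePartition Y) (hQB : 𝔔.IsBorel) (hPB : 𝔓.IsBorel)
    (hQ : 𝔔.Coarser 𝔓) :
    SoficEntropy.entropy d ℙ p β π μ hQ =
      ⨅ (F : Finset 𝓗.PartialAut) (_ : ∀ f ∈ F, f.IsTop ν)
        (hF : SoficEntropy.DiscreteBorelGroupoid.PartialAut.one 𝓗 ∈ F) (δ : ℝ) (_ : 0 < δ),
        SoficEntropy.entropyAt d ℙ p β π μ hQ F hF δ := by
  refine le_antisymm ?_ ?_
  · exact le_iInf₂ fun F _ => iInf_le _ F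
  · refine le_iInf₂ fun F hF => le_iInf₂ fun δ hδ => ?_
    obtain ⟨F', htopF, hF', δ', hδ', hle⟩ := SoficEntropy.exists_isTop_entropyAt_le htop hetale
      hpmp hreg hsofic.tendsto_atTop hcont p β π hπ hPB hQ F hF hδ
    exact iInf₂_le_of_le F' htopF (iInf₂_le_of_le hF' δ' (iInf_le_of_le hδ' hle))
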